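/- Fix $\alpha>0$. Let $\Psi:\mathbb R\to[0,\infty)$ be the even function with $$\Psi(y)=\begin{cases}\alpha y^2-\tfrac13y^3,&0\le y<\alpha,\\ \tfrac23\alpha^3+\alpha^2(y-\alpha)+(y-\alpha)^3,&y\ge\alpha,\end{cases}$$ let $\mathcal L^\Psi$ be the Orlicz space of measurable $f:\mathbb R\to\mathbb R$ with $\int_{\mathbb R}\Psi(cf)\,dx<\infty$ for some $c>0$ (it is contained in $L^2(\mathbb R)$), and let $N_\Psi(f)=\inf\{\lambda>0:\int_{\mathbb R}\Psi(f/\lambda)\,dx\le1\}$ be its gauge norm. Let $f\mapsto K_{1/4}*f$ be the operator on $L^2(\mathbb R)$ with Fourier symbol $\left(\frac{\tanh\xi}{\xi}\right)^{1/4}$, where $\hat f(\xi)=\int_{\mathbb R} f(x)e^{-ix\xi}\,dx$. For $l\in\mathbb N$, a local maximiser $f_l$ is a function that maximises $\|K_{1/4}*f\|_{L^2}$ among all $f\in\mathcal L^\Psi$ with $N_\Psi(f)=1$ that vanish almost everywhere outside $[-2^l,2^l]$. Then $B=\frac{4}{\sqrt3}\cos\left(\frac{5\pi}{18}\right)\alpha\approx1.48\,\alpha$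 is the unique solution $y>0$ of $2\Psi(y)=y\Psi'(y)$. Moreover, for every $\varepsilon>0$ there is an $l_0$, depending only on $\varepsilon$ and $\alpha$, such that for all $l>l_0$ every local maximiser $f_l$ satisfies $$\int_{\{f_l\ge B\}}|f_l-B|\,dx<\varepsilon .$$ -/

import Mathlib

open MeasureTheory Filter Set
open scoped ENNReal FourierTransform

/-- The even Young function `Ψ` with parameter `a`, given on the positive half-line by
`a y² - y³/3` for `y < a` and `2a³/3 + a²(y - a) + (y - a)³` for `y ≥ a`. -/
noncomputable def youngPsi (a y : ℝ) : ℝ :=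
  if |y| < a then a * |y| ^ 2 - |y| ^ 3 / 3
  else 2 / 3 * a ^ 3 + a ^ 2 * (|y| - a) + (|y| - a) ^ 3

/-- The modular `∫ Ψ(f) dx`, as an extended nonnegative number (so it is `∞` exactly when the
nonnegative function `Ψ(f)` is not integrable). -/
noncomputable def modular (a : ℝ) (f : ℝ → ℝ) : ℝ≥0∞ :=
  ∫⁻ x, ENNReal.ofReal (youngPsi a (f x))

/-- Membership in the Orlicz space of `Ψ`: `f` is measurable (up to a null set) and
`∫ Ψ(c f) dx < ∞` for some `c > 0`. -/
def MemOrlicz (a : ℝ) (f : ℝ → ℝ) : Prop :=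
  AEStronglyMeasurable f ∧ ∃ c : ℝ, 0 < c ∧ modular a (fun x => c * f x) < ∞

/-- The gauge (Minkowski, Luxemburg) norm `inf {r > 0 : ∫ Ψ(f / r) dx ≤ 1}`. -/
noncomputable def gaugeNorm (a : ℝ) (f : ℝ → ℝ) : ℝ :=
  sInf {r : ℝ | 0 < r ∧ modular a (fun x => f x / r) ≤ 1}

/-- The symbol `(tanh ξ / ξ) ^ s`, with its continuous value `1` at `ξ = 0`. It is the Fourier
transform `∫ K_s(x) e^{-i x ξ} dx` of the kernel `K_s`. -/
noncomputable def whithamSymbol (s ξ : ℝ) : ℝ :=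
  if ξ = 0 then 1 else (Real.tanh ξ / ξ) ^ s

theorem tanh_div_self_mem {x : ℝ} (hx : x ≠ 0) :
    0 ≤ Real.tanh x / x ∧ Real.tanh x / x ≤ 1 := by
  have key : ∀ y : ℝ, 0 < y → 0 ≤ Real.tanh y / y ∧ Real.tanh y / y ≤ 1 := by
    intro y hy
    have hc := Real.cosh_pos y
    have hs : Real.sinh y ≤ y * Real.cosh y := by
      have hmono : MonotoneOn (fun t : ℝ => t * Real.cosh t - Real.sinh t) (Ici 0) := by
        apply monotoneOn_of_deriv_nonneg (convex_Ici 0)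
        · fun_prop
        · fun_prop
        · intro t ht
          rw [interior_Ici] at ht
          have hd : HasDerivAt (fun t : ℝ => t * Real.cosh t - Real.sinh t)
              (1 * Real.cosh t + t * Real.sinh t - Real.cosh t) t :=
            ((hasDerivAt_id t).mul (Real.hasDerivAt_cosh t)).sub (Real.hasDerivAt_sinh t)
          rw [hd.deriv]
          have := mul_nonneg (le_of_lt ht) (Real.sinh_nonneg_iff.2 (le_of_lt ht))
          linarith
      have h := hmono (self_mem_Ici) (mem_Ici.2 hy.le) hy.le
      simp at h
      linarith
    rw [Real.tanh_eq_sinh_div_cosh]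
    have h0 : 0 ≤ Real.sinh y := Real.sinh_nonneg_iff.2 hy.le
    refine ⟨by positivity, ?_⟩
    rw [div_div, div_le_one (by positivity)]
    linarith
  rcases lt_or_gt_of_ne hx with h | h
  · have := key (-x) (by linarith)
    rwa [Real.tanh_neg, neg_div_neg_eq] at this
  · exact key x h

theorem abs_whithamSymbol_le_one {s : ℝ} (hs : 0 ≤ s) (ξ : ℝ) : |whithamSymbol s ξ| ≤ 1 := by
  unfold whithamSymbol
  split_ifs with h
  · simp
  · obtain ⟨h0, h1⟩ := tanh_div_self_mem h
    rw [abs_of_nonneg (Real.rpow_nonneg h0 s)]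
    exact Real.rpow_le_one h0 h1 hs

theorem measurable_whithamSymbol (s : ℝ) : Measurable (whithamSymbol s) := by
  unfold whithamSymbol
  have ht : Measurable Real.tanh := by
    have : Real.tanh = fun x => Real.sinh x / Real.cosh x :=
      funext Real.tanh_eq_sinh_div_cosh
    rw [this]
    exact Real.measurable_sinh.div Real.measurable_cosh
  exact Measurable.ite (measurableSet_singleton 0) measurable_const
    ((ht.div measurable_id).pow_const s)

theorem memLp_whithamSymbol_mul {s : ℝ} (hs : 0 ≤ s) (F : Lp ℂ 2 (volume : Measure ℝ)) :
    MemLp (fun w : ℝ => (whithamSymbol s (2 * Real.pi * w) : ℂ) * F w) 2 := by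
  have hm : Measurable (fun w : ℝ => (whithamSymbol s (2 * Real.pi * w) : ℂ)) :=
    Complex.measurable_ofReal.comp
      ((measurable_whithamSymbol s).comp (measurable_const.mul measurable_id))
  refine (Lp.memLp F).of_le (hm.aestronglyMeasurable.mul (Lp.aestronglyMeasurable F)) ?_
  refine Eventually.of_forall fun w => ?_
  rw [norm_mul, Complex.norm_real, Real.norm_eq_abs]
  exact mul_le_of_le_one_left (norm_nonneg _) (abs_whithamSymbol_le_one hs _)

/-- The convolution operator `f ↦ K_s ∗ f` on `L²(ℝ)`, where the kernel `K_s` is the inverse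
Fourier transform of `(tanh ξ / ξ) ^ s`: the operator with Fourier symbol `(tanh ξ / ξ) ^ s`.
The Fourier transform `𝓕` used here has the phase `e^{-2π i x w}`, so the frequency is
`ξ = 2π w`. -/
noncomputable def whithamConv (s : ℝ) (hs : 0 ≤ s) (f : Lp ℂ 2 (volume : Measure ℝ)) :
    Lp ℂ 2 (volume : Measure ℝ) :=
  𝓕⁻ ((memLp_whithamSymbol_mul hs (𝓕 f)).toLp)

theorem third_mul_sq_le_youngPsi {a : ℝ} (ha : 0 < a) (y : ℝ) :
    a / 3 * y ^ 2 ≤ youngPsi a y := by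
  unfold youngPsi
  rw [← sq_abs y]
  have h0 := abs_nonneg y
  generalize |y| = t at *
  split_ifs with h
  · nlinarith [mul_nonneg (sq_nonneg t) (sub_nonneg.2 h.le), sq_nonneg t,
      mul_nonneg ha.le (sq_nonneg t)]
  · obtain ⟨u, rfl⟩ : ∃ u, t = a + u := ⟨t - a, by ring⟩
    have hu : 0 ≤ u := by linarith
    have : a + u - a = u := by ring
    rw [this]
    nlinarith [mul_nonneg hu (sq_nonneg (a - u)), mul_nonneg ha.le (sq_nonneg u),
      pow_pos ha 3, pow_nonneg hu 3, mul_nonneg (sq_nonneg a) hu]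

/-- The Orlicz space of `Ψ` is contained in `L²`. -/
theorem MemOrlicz.memLp_two {a : ℝ} (ha : 0 < a) {f : ℝ → ℝ} (hf : MemOrlicz a f) :
    MemLp f 2 := by
  obtain ⟨hm, c, hc, hfin⟩ := hf
  rw [memLp_two_iff_integrable_sq hm]
  have hK : 0 < a / 3 * c ^ 2 := by positivity
  have h1 : Integrable (fun x => a / 3 * c ^ 2 * f x ^ 2) := by
    refine ⟨(hm.pow 2).const_mul _, ?_⟩
    rw [hasFiniteIntegral_iff_ofReal (Eventually.of_forall fun x => by positivity)]
    refine lt_of_le_of_lt (lintegral_mono fun x => ENNReal.ofReal_le_ofReal ?_) hfin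
    have := third_mul_sq_le_youngPsi ha (c * f x)
    calc a / 3 * c ^ 2 * f x ^ 2 = a / 3 * (c * f x) ^ 2 := by ring
      _ ≤ _ := this
  have h2 := h1.const_mul (a / 3 * c ^ 2)⁻¹
  refine h2.congr (Eventually.of_forall fun x => ?_)
  simp only
  rw [← mul_assoc, inv_mul_cancel₀ hK.ne', one_mul]

open Classical in
/-- The functional `𝓙(f) = ‖K_{1/4} ∗ f‖_{L²}` of a real function `f ∈ L²(ℝ)`. It is evaluated
only on the Orlicz space of `Ψ`, which is contained in `L²`. -/
noncomputable def dispersiveEnergy (f : ℝ → ℝ) : ℝ :=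
  if hf : MemLp (fun x => (f x : ℂ)) 2 (volume : Measure ℝ) then
    ‖whithamConv (1 / 4) (by norm_num) hf.toLp‖
  else 0

/-- The constraint of the local problem on `[-2^l, 2^l]`: `f` lies in the Orlicz space of `Ψ`,
has gauge norm one, and vanishes (almost everywhere) outside `[-2^l, 2^l]`. -/
def localConstraint (a : ℝ) (l : ℕ) : Set (ℝ → ℝ) :=
  {f | MemOrlicz a f ∧ gaugeNorm a f = 1 ∧
    ∀ᵐ x : ℝ, x ∉ Icc (-(2 : ℝ) ^ l) ((2 : ℝ) ^ l) → f x = 0}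

/-- `f` is a maximiser of `𝓙` under the constraint of the local problem on `[-2^l, 2^l]`. -/
def IsLocalMaximiser (a : ℝ) (l : ℕ) (f : ℝ → ℝ) : Prop :=
  f ∈ localConstraint a l ∧ IsMaxOn dispersiveEnergy (localConstraint a l) f

/-- The height `B = (4/√3) cos(5π/18) a`. -/
noncomputable def heightB (a : ℝ) : ℝ :=
  4 / Real.sqrt 3 * Real.cos (5 * Real.pi / 18) * a

/-! Let `m` be the square of the symbol, so that `m ≤ m 0 = 1`, and let `c = 𝓙(f)²` be its quadratic
form at a maximiser `f`. At the height `B` the tangent line of `Ψ` is `Ψ(B) (1 + 2h/B)`. Replacing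
the values `B + h` on `dx` by the value `B` on `(1 + 2h/B) dx` therefore costs only second order
terms: `∫ f²` loses `h²`, while the modular drops by `3(B - a)h² + h³`. Low, wide test functions
give `a c ≥ 1 - σ` for large `l` (`eventually_exists_energy_ge`), and `3(B - a) > 1.4 a`, so `∫ f² -
c ∫ Ψ(f)` grows by at least `∫ h² / 5`. Mass above `B` is thus wasteful, as long as the operation
does not increase the Dirichlet form `∫ f² - 𝓙(f)²`.

For a Gaussian symbol that form is `½ ∬ k(x - y) (f x - f y)²` with `k` radially decreasing, and
stretching the line only separates points (`IsReparam.dirichlet_le_of_stretch`). The comparison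
extends to every Gaussian mixture (`GaussMix.energy_sub_le`), and `(tanh ξ / ξ)^(1/2)` is one, by
the partial fractions of `x coth x` (`gaussMix_whithamSymbol_sq`).

A stretched function may leave `[-2^l, 2^l]`. So `|f|` is first lowered by a small `δ` and the gaps
where it vanishes are compressed, which confines the support to an interval independent of `l`
(`exists_truncation`) at a cost of order `σ + δ`. The result `g` has modular `P ≤ 1` and energy at
least `c P + η` (energies here are squares of `𝓙`). Dilating by `1/P` restores modular one and
multiplies the energy by at least `1/P`, so it exceeds `c`, contradicting maximality
(`exists_energy_lt`). -/

/-! ### The Young function and the height `B`. -/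

theorem youngPsi_abs (a y : ℝ) : youngPsi a |y| = youngPsi a y := by simp [youngPsi]

theorem youngPsi_zero {a : ℝ} (ha : 0 < a) : youngPsi a 0 = 0 := by simp [youngPsi, ha]

theorem youngPsi_nonneg {a : ℝ} (ha : 0 < a) (y : ℝ) : 0 ≤ youngPsi a y :=
  le_trans (by positivity) (third_mul_sq_le_youngPsi ha y)

/-- A closed form of `Ψ` on the positive half-line. -/
theorem youngPsi_eq {a y : ℝ} (hy : 0 ≤ y) :
    youngPsi a y = a * y ^ 2 - y ^ 3 / 3 + 4 / 3 * (max (y - a) 0) ^ 3 := by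
  unfold youngPsi
  rw [abs_of_nonneg hy]
  split_ifs with h
  · rw [max_eq_right (by linarith)]; ring
  · rw [max_eq_left (by linarith)]; ring

theorem youngPsi_eq_abs (a y : ℝ) :
    youngPsi a y = a * |y| ^ 2 - |y| ^ 3 / 3 + 4 / 3 * (max (|y| - a) 0) ^ 3 := by
  rw [← youngPsi_abs, youngPsi_eq (abs_nonneg y)]

theorem continuous_youngPsi (a : ℝ) : Continuous (youngPsi a) := by
  rw [funext (youngPsi_eq_abs a)]
  fun_prop

theorem hasDerivAt_max_zero_pow_three (x : ℝ) :
    HasDerivAt (fun u : ℝ => (max u 0) ^ 3) (3 * (max x 0) ^ 2) x := by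
  rcases lt_trichotomy x 0 with h | h | h
  · rw [max_eq_right h.le]
    have := (hasDerivAt_const x (0 : ℝ)).congr_of_eventuallyEq
      (f₁ := fun u : ℝ => (max u 0) ^ 3) ?_
    · simpa using this
    · filter_upwards [gt_mem_nhds h] with u hu
      simp [max_eq_right hu.le]
  · subst h
    rw [hasDerivAt_iff_tendsto_slope_zero]
    have hc : Continuous fun t : ℝ => max t 0 ^ 2 := by fun_prop
    have := (hc.tendsto 0).mono_left (nhdsWithin_le_nhds (s := {0}ᶜ))
    simp only [max_self] at this ⊢
    refine Tendsto.congr' ?_ (by simpa using this)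
    filter_upwards [self_mem_nhdsWithin] with t ht
    have ht : t ≠ 0 := ht
    rcases le_total t 0 with h | h
    · simp [max_eq_right h]
    · simp [max_eq_left h]
      field_simp
  · rw [max_eq_left h.le]
    have := (hasDerivAt_pow 3 x).congr_of_eventuallyEq
      (f₁ := fun u : ℝ => (max u 0) ^ 3) ?_
    · simpa using this
    · filter_upwards [lt_mem_nhds h] with u hu
      simp [max_eq_left hu.le]

theorem hasDerivAt_youngPsi {a y : ℝ} (hy : 0 < y) :
    HasDerivAt (youngPsi a) (2 * a * y - y ^ 2 + 4 * (max (y - a) 0) ^ 2) y := by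
  have h1 : HasDerivAt (fun y : ℝ => a * y ^ 2 - y ^ 3 / 3 + 4 / 3 * (max (y - a) 0) ^ 3)
      (a * (2 * y) - 3 * y ^ 2 / 3 + 4 / 3 * (3 * (max (y - a) 0) ^ 2 * 1)) y := by
    refine ((((hasDerivAt_pow 2 y).const_mul a).congr_deriv (by simp)).sub
      (((hasDerivAt_pow 3 y).div_const 3).congr_deriv (by simp))).add
      (HasDerivAt.const_mul _ ?_)
    exact (hasDerivAt_max_zero_pow_three (y - a)).comp y ((hasDerivAt_id y).sub_const a)
  refine (h1.congr_of_eventuallyEq ?_).congr_deriv (by ring)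
  filter_upwards [lt_mem_nhds hy] with u hu using youngPsi_eq hu.le

theorem youngPsi_le_mul_sq {a y : ℝ} (hy : 0 ≤ y) (hya : y ≤ a) :
    youngPsi a y ≤ a * y ^ 2 := by
  rw [youngPsi_eq hy, max_eq_right (by linarith)]
  have := pow_nonneg hy 3
  linarith

/-- A consequence of convexity and `Ψ(0) = 0`, obtained by differentiating `Ψ(s z) - s Ψ(z)` in `s`.
It yields the monotonicity of `Ψ` and the passage from modular one to gauge norm one. -/
theorem mul_youngPsi_le {a t : ℝ} (ha : 0 < a) (ht : 1 ≤ t) (y : ℝ) :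
    t * youngPsi a y ≤ youngPsi a (t * y) := by
  rw [← youngPsi_abs a y, ← youngPsi_abs a (t * y), abs_mul, abs_of_pos (by linarith : 0 < t)]
  have hz := abs_nonneg y
  generalize |y| = z at *
  have key : MonotoneOn (fun s : ℝ => youngPsi a (s * z) - s * youngPsi a z) (Ici 1) := by
    rcases hz.eq_or_lt with rfl | hz
    · simp [youngPsi_zero ha, MonotoneOn]
    have hd : ∀ s : ℝ, 0 < s → HasDerivAt (fun s : ℝ => youngPsi a (s * z) - s * youngPsi a z)
        ((2 * a * (s * z) - (s * z) ^ 2 + 4 * (max (s * z - a) 0) ^ 2) * (1 * z)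
          - 1 * youngPsi a z) s := fun s hs =>
      HasDerivAt.fun_sub
        (((hasDerivAt_youngPsi (mul_pos hs hz)).comp (h := fun s => s * z) s
          (hasDerivAt_mul_const z)).congr_deriv (by rw [one_mul]))
        ((hasDerivAt_id s).mul_const _)
    apply monotoneOn_of_deriv_nonneg (convex_Ici 1)
    · exact fun s hs => (hd s (lt_of_lt_of_le one_pos hs)).continuousAt.continuousWithinAt
    · intro s hs
      rw [interior_Ici] at hs
      exact (hd s (lt_trans one_pos hs)).differentiableAt.differentiableWithinAt
    · intro s hs
      rw [interior_Ici] at hs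
      have hs : 1 < s := hs
      rw [(hd s (lt_trans one_pos hs)).deriv, youngPsi_eq hz.le]
      have h1 : z ≤ s * z := by nlinarith
      generalize s * z = x at *
      rcases le_total x a with hx | hx
      · rw [max_eq_right (by linarith), max_eq_right (by linarith)]
        nlinarith [mul_nonneg hz.le (mul_nonneg (sub_nonneg.2 h1) (sub_nonneg.2 hx)),
          mul_nonneg hz.le (mul_nonneg (sub_nonneg.2 h1) (sub_nonneg.2 (h1.trans hx))),
          mul_nonneg (sq_nonneg z) (sub_nonneg.2 (h1.trans hx)), pow_pos hz 3]
      · rw [max_eq_left (by linarith : 0 ≤ x - a)]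
        rcases le_total z a with hza | hza
        · rw [max_eq_right (by linarith)]
          nlinarith [mul_nonneg hz.le (sq_nonneg (x - a)), mul_nonneg hz.le (sq_nonneg (z - a)),
            pow_pos hz 3, mul_pos hz (mul_pos ha ha),
            mul_nonneg hz.le (mul_nonneg ha.le (sub_nonneg.2 hza))]
        · rw [max_eq_left (by linarith)]
          obtain ⟨u, hu, rfl⟩ : ∃ u, 0 ≤ u ∧ z = a + u := ⟨z - a, by linarith, by ring⟩
          obtain ⟨v, hv, rfl⟩ : ∃ v, 0 ≤ v ∧ x = a + u + v :=
            ⟨x - (a + u), by linarith, by ring⟩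
          ring_nf
          positivity
  have := key (mem_Ici.2 le_rfl) (mem_Ici.2 ht) ht
  simp only [one_mul, sub_self] at this
  linarith

/-- The price of lowering `y` by `δ`. Since `a c ≥ 1 - σ`, the quadratic parts of `y²` and `c Ψ(y)`
nearly cancel: the derivative of `y² - c Ψ(y)` is at most `2σy + 3y²/a`, which is the derivative of
`σy² + y³/a`. -/
theorem sub_mul_youngPsi_le {a c σ δ y : ℝ} (ha : 0 < a) (hc0 : 0 ≤ c) (hc : 1 - σ ≤ a * c)
    (hc' : c ≤ 3 / a) (hσ : 0 ≤ σ) (hδ : 0 ≤ δ) (hy : 0 ≤ y) :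
    (y ^ 2 - c * youngPsi a y) - ((max (y - δ) 0) ^ 2 - c * youngPsi a (max (y - δ) 0))
      ≤ (σ + 3 * δ / a) * y ^ 2 := by
  have hd : ∀ z : ℝ, 0 < z → HasDerivAt
      (fun z : ℝ => z ^ 2 - c * youngPsi a z - σ * z ^ 2 - 1 / a * z ^ 3)
      (2 * z - c * (2 * a * z - z ^ 2 + 4 * (max (z - a) 0) ^ 2) - σ * (2 * z)
        - 1 / a * (3 * z ^ 2)) z := fun z hz =>
    ((((hasDerivAt_pow 2 z).congr_deriv (by simp)).sub
      ((hasDerivAt_youngPsi hz).const_mul c)).sub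
      (((hasDerivAt_pow 2 z).congr_deriv (by simp)).const_mul σ)).sub
      (((hasDerivAt_pow 3 z).congr_deriv (by simp)).const_mul (1 / a))
  have key : AntitoneOn (fun z : ℝ => z ^ 2 - c * youngPsi a z - σ * z ^ 2 - 1 / a * z ^ 3)
      (Ici 0) := by
    apply antitoneOn_of_deriv_nonpos (convex_Ici 0)
    · have := continuous_youngPsi a
      fun_prop
    · intro z hz
      rw [interior_Ici] at hz
      exact (hd z hz).differentiableAt.differentiableWithinAt
    · intro z hz
      rw [interior_Ici] at hz
      have hz : 0 < z := hz
      rw [(hd z hz).deriv]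
      have h1 : (1 - σ) * z ≤ a * c * z := by gcongr
      have h2 : c * z ^ 2 ≤ 3 / a * z ^ 2 := by gcongr
      have h3 : 3 / a * z ^ 2 = 1 / a * (3 * z ^ 2) := by ring
      nlinarith [mul_nonneg hc0 (sq_nonneg (max (z - a) 0))]
  have hm0 : 0 ≤ max (y - δ) 0 := le_max_right _ _
  have hmy : max (y - δ) 0 ≤ y := max_le (by linarith) hy
  have hmd : y - δ ≤ max (y - δ) 0 := le_max_left _ _
  have h := key (mem_Ici.2 hm0) (mem_Ici.2 hy) hmy
  simp only at h
  generalize max (y - δ) 0 = v at *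
  have e1 : σ * (y ^ 2 - v ^ 2) ≤ σ * y ^ 2 := by gcongr; nlinarith
  have e2 : y ^ 3 - v ^ 3 ≤ 3 * δ * y ^ 2 := by
    have : y ^ 3 - v ^ 3 = (y - v) * (y ^ 2 + y * v + v ^ 2) := by ring
    rw [this]
    have i1 : y ^ 2 + y * v + v ^ 2 ≤ 3 * y ^ 2 := by nlinarith
    calc _ ≤ δ * (3 * y ^ 2) := by gcongr; · linarith
      _ = _ := by ring
  have e3 : 1 / a * (y ^ 3 - v ^ 3) ≤ 1 / a * (3 * δ * y ^ 2) := by gcongr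
  have e4 : (σ + 3 * δ / a) * y ^ 2 = σ * y ^ 2 + 1 / a * (3 * δ * y ^ 2) := by ring
  rw [e4]
  linarith

theorem exists_youngPsi_eq {a q : ℝ} (ha : 0 < a) (hq : 0 ≤ q) (hq' : q ≤ 2 / 3 * a ^ 3) :
    ∃ y, 0 ≤ y ∧ y ≤ a ∧ youngPsi a y = q := by
  have h := intermediate_value_Icc ha.le (continuous_youngPsi a).continuousOn
  have : q ∈ Icc (youngPsi a 0) (youngPsi a a) := by
    rw [youngPsi_zero ha, youngPsi_eq ha.le]
    refine ⟨hq, hq'.trans (le_of_eq ?_)⟩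
    simp; ring
  obtain ⟨y, hy, rfl⟩ := h this
  exact ⟨y, hy.1, hy.2, rfl⟩

/-- Viète's trigonometric solution: the factor `4/√3` turns the cubic into the triple angle formula,
and `3 · 5π/18 = π - π/6` has cosine `-√3/2`. -/
theorem heightB_cubic (a : ℝ) : heightB a ^ 3 - 4 * a ^ 2 * heightB a + 8 / 3 * a ^ 3 = 0 := by
  have hc : Real.cos (3 * (5 * Real.pi / 18)) = -(Real.sqrt 3 / 2) := by
    rw [show 3 * (5 * Real.pi / 18) = Real.pi - Real.pi / 6 by ring, Real.cos_pi_sub,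
      Real.cos_pi_div_six]
  rw [Real.cos_three_mul] at hc
  unfold heightB
  have h3 : Real.sqrt 3 ^ 2 = 3 := Real.sq_sqrt (by norm_num)
  have hs : Real.sqrt 3 ≠ 0 := by positivity
  generalize Real.cos (5 * Real.pi / 18) = x at *
  generalize Real.sqrt 3 = s at *
  have hs3 : s ^ 3 = 3 * s := by rw [pow_succ, h3]
  field_simp
  rw [hs3, h3]
  linear_combination (48 * a ^ 3) * hc

theorem heightB_bounds {a : ℝ} (ha : 0 < a) :
    1.475 * a ≤ heightB a ∧ heightB a ≤ 1.485 * a := by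
  have h := heightB_cubic a
  have h1 : a ≤ heightB a := by
    unfold heightB
    have hcos : 1 / 2 ≤ Real.cos (5 * Real.pi / 18) := by
      rw [← Real.cos_pi_div_three]
      have := Real.pi_pos
      exact Real.cos_le_cos_of_nonneg_of_le_pi (by positivity) (by linarith) (by linarith)
    have hs : Real.sqrt 3 ≤ 2 := by
      rw [Real.sqrt_le_left (by norm_num)]; norm_num
    have : 1 ≤ 4 / Real.sqrt 3 * Real.cos (5 * Real.pi / 18) := by
      calc (1 : ℝ) = 4 / 2 * (1 / 2) := by norm_num
        _ ≤ _ := by gcongr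
    nlinarith
  obtain ⟨b, hb⟩ : ∃ b, heightB a = b * a := ⟨heightB a / a, by field_simp⟩
  rw [hb] at h h1 ⊢
  have hb1 : 1 ≤ b := by nlinarith
  have hc : b ^ 3 - 4 * b + 8 / 3 = 0 := by
    have : a ^ 3 * (b ^ 3 - 4 * b + 8 / 3) = 0 := by linarith [h]
    exact (mul_eq_zero.1 this).resolve_left (by positivity)
  constructor
  · gcongr
    nlinarith [mul_nonneg (sub_nonneg.2 hb1) (sub_nonneg.2 hb1)]
  · gcongr
    by_contra! hlt
    nlinarith [mul_pos (sub_pos.2 hlt) (sub_pos.2 hlt)]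

/-- Below `a` the two sides differ by `y³/3 > 0`. Above `a` the equation is the cubic of
`heightB_cubic`, whose cofactor `y² + yB + B² - 4a²` is positive because `y ≥ a` and `B ≥ 1.475 a`.
-/
theorem two_mul_youngPsi_eq_iff {a y : ℝ} (ha : 0 < a) (hy : 0 < y) :
    2 * youngPsi a y = y * deriv (youngPsi a) y ↔ y = heightB a := by
  have hB := heightB_cubic a
  obtain ⟨h1, h2⟩ := heightB_bounds ha
  rw [(hasDerivAt_youngPsi hy).deriv, youngPsi_eq hy.le]
  generalize heightB a = B at *
  rcases lt_or_ge y a with h | h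
  · rw [max_eq_right (by linarith)]
    constructor
    · intro h; have := pow_pos hy 3; nlinarith
    · intro h; linarith
  · rw [max_eq_left (by linarith)]
    constructor
    · intro he
      have hc : y ^ 3 - 4 * a ^ 2 * y + 8 / 3 * a ^ 3 = 0 := by linarith
      have : (y - B) * (y ^ 2 + y * B + B ^ 2 - 4 * a ^ 2) = 0 := by linarith
      rcases mul_eq_zero.1 this with h' | h'
      · linarith
      · nlinarith
    · rintro rfl
      linarith

/-- At the height `B` the tangent line of `Ψ` is `Ψ(B) (1 + 2 h / B)`. -/
theorem youngPsi_heightB_mul {a h : ℝ} (ha : 0 < a) (hh : 0 ≤ h) :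
    youngPsi a (heightB a) * (1 + 2 / heightB a * h)
      = youngPsi a (heightB a + h) - 3 * (heightB a - a) * h ^ 2 - h ^ 3 := by
  have hB := heightB_cubic a
  obtain ⟨h1, h2⟩ := heightB_bounds ha
  generalize heightB a = B at *
  have hBpos : 0 < B := by nlinarith
  rw [youngPsi_eq hBpos.le, youngPsi_eq (by positivity), max_eq_left (by nlinarith),
    max_eq_left (by nlinarith)]
  field_simp
  linear_combination (-3 * h) * hB

/-! ### Gaussian mixtures and the Whitham symbol. -/

/-- The cone of Gaussian mixtures: the smallest set of functions that contains the centred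
Gaussians and is closed under nonnegative multiples, sums and pointwise limits of sequences. -/
inductive GaussMix : (ℝ → ℝ) → Prop
  | gauss (t : ℝ) (ht : 0 < t) : GaussMix fun x => Real.exp (-t * x ^ 2)
  | smul {m : ℝ → ℝ} (c : ℝ) (hc : 0 ≤ c) (hm : GaussMix m) : GaussMix fun x => c * m x
  | add {m n : ℝ → ℝ} (hm : GaussMix m) (hn : GaussMix n) : GaussMix fun x => m x + n x
  | lim {m : ℕ → ℝ → ℝ} {n : ℝ → ℝ} (hm : ∀ k, GaussMix (m k))
      (h : ∀ x, Tendsto (fun k => m k x) atTop (nhds (n x))) : GaussMix n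

namespace GaussMix

theorem measurable {m : ℝ → ℝ} (hm : GaussMix m) : Measurable m := by
  induction hm with
  | gauss t ht => fun_prop
  | smul c hc hm ih => exact ih.const_mul c
  | add hm hn ih1 ih2 => exact ih1.add ih2
  | lim hm h ih => exact measurable_of_tendsto_metrizable ih (tendsto_pi_nhds.2 h)

theorem nonneg {m : ℝ → ℝ} (hm : GaussMix m) (x : ℝ) : 0 ≤ m x := by
  induction hm with
  | gauss t ht => positivity
  | smul c hc hm ih => exact mul_nonneg hc ih
  | add hm hn ih1 ih2 => exact add_nonneg ih1 ih2
  | lim hm h ih => exact ge_of_tendsto' (h x) ih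

theorem anti {m : ℝ → ℝ} (hm : GaussMix m) {x y : ℝ} (hxy : |x| ≤ |y|) : m y ≤ m x := by
  induction hm with
  | gauss t ht =>
    have := sq_le_sq.2 hxy
    exact Real.exp_le_exp.2 (by nlinarith)
  | smul c hc hm ih => exact mul_le_mul_of_nonneg_left ih hc
  | add hm hn ih1 ih2 => exact add_le_add ih1 ih2
  | lim hm h ih => exact le_of_tendsto_of_tendsto' (h y) (h x) ih

theorem le_apply_zero {m : ℝ → ℝ} (hm : GaussMix m) (x : ℝ) : m x ≤ m 0 :=
  hm.anti (by simp)

theorem congr {m n : ℝ → ℝ} (hm : GaussMix m) (h : ∀ x, m x = n x) : GaussMix n :=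
  funext h ▸ hm

theorem const (c : ℝ) (hc : 0 ≤ c) : GaussMix fun _ => c := by
  have h1 : GaussMix fun _ => (1 : ℝ) := by
    refine lim (m := fun k x => Real.exp (-(1 / ((k : ℝ) + 1)) * x ^ 2))
      (fun k => gauss _ (by positivity)) fun x => ?_
    have h : Tendsto (fun k : ℕ => -(1 / ((k : ℝ) + 1)) * x ^ 2) atTop (nhds (-0 * x ^ 2)) :=
      (tendsto_one_div_add_atTop_nhds_zero_nat.neg).mul_const _
    simpa [Function.comp_def] using (Real.continuous_exp.tendsto _).comp h
  exact (smul c hc h1).congr fun _ => mul_one c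

theorem mul {m n : ℝ → ℝ} (hm : GaussMix m) (hn : GaussMix n) :
    GaussMix fun x => m x * n x := by
  induction hm with
  | gauss t ht =>
    induction hn with
    | gauss s hs =>
      refine (gauss (t + s) (add_pos ht hs)).congr fun x => ?_
      rw [← Real.exp_add]; ring_nf
    | smul c hc hm ih => exact (smul c hc ih).congr fun x => by ring
    | add hm hn ih1 ih2 => exact (add ih1 ih2).congr fun x => by ring
    | lim hm h ih => exact lim ih fun x => (h x).const_mul _
  | smul c hc hm ih => exact (smul c hc ih).congr fun x => by ring
  | add hm hn ih1 ih2 => exact (add ih1 ih2).congr fun x => by ring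
  | lim hm h ih => exact lim ih fun x => (h x).mul_const _

theorem pow {m : ℝ → ℝ} (hm : GaussMix m) (k : ℕ) : GaussMix fun x => m x ^ k := by
  induction k with
  | zero => exact (const 1 zero_le_one).congr fun x => (pow_zero _).symm
  | succ k ih => exact (ih.mul hm).congr fun x => (pow_succ _ _).symm

theorem sum {m : ℕ → ℝ → ℝ} (hm : ∀ k, GaussMix (m k)) (n : ℕ) :
    GaussMix fun x => ∑ k ∈ Finset.range n, m k x := by
  induction n with
  | zero => exact (const 0 le_rfl).congr fun x => by simp
  | succ k ih => exact (ih.add (hm k)).congr fun x => (Finset.sum_range_succ _ _).symm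

theorem inv_one_sub {m : ℝ → ℝ} (hm : GaussMix m) (h : ∀ x, m x < 1) :
    GaussMix fun x => (1 - m x)⁻¹ :=
  lim (sum fun k => hm.pow k) fun x =>
    (hasSum_geometric_of_lt_one (hm.nonneg x) (h x)).tendsto_sum_nat

/-- The number `r = 1 - √(1 - m)` solves `r = (m + r²)/2`. The iteration of this equation from `0`
uses only sums, products and nonnegative constants, so it stays in the cone. Then `1/√(1 - m) = 1/(1
- r)` is a geometric series in `r`. -/
theorem inv_sqrt_one_sub {m : ℝ → ℝ} (hm : GaussMix m) (h : ∀ x, m x < 1) :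
    GaussMix fun x => (Real.sqrt (1 - m x))⁻¹ := by
  let p : ℕ → ℝ → ℝ := fun k =>
    Nat.rec (fun _ => 0) (fun _ q x => 1 / 2 * (m x + q x ^ 2)) k
  have hp : ∀ k, GaussMix (p k) := by
    intro k
    induction k with
    | zero => exact const 0 le_rfl
    | succ k ih => exact smul _ (by norm_num) (hm.add (ih.pow 2))
  have hr : GaussMix fun x => 1 - Real.sqrt (1 - m x) := by
    refine lim hp fun x => ?_
    have hx0 := hm.nonneg x
    have hx1 := h x
    have hs : Real.sqrt (1 - m x) ^ 2 = 1 - m x := Real.sq_sqrt (by linarith)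
    have hs0 : 0 < Real.sqrt (1 - m x) := Real.sqrt_pos.2 (by linarith)
    have hs1 : Real.sqrt (1 - m x) ≤ 1 := Real.sqrt_le_one.2 (by linarith)
    set r := 1 - Real.sqrt (1 - m x) with hrdef
    have hmr : m x = 2 * r - r ^ 2 := by
      have : Real.sqrt (1 - m x) = 1 - r := by rw [hrdef]; ring
      rw [this] at hs; linarith
    have hr0 : 0 ≤ r := by linarith
    have hr1 : r < 1 := by linarith
    -- One iteration multiplies the error by `(r + p k x)/2 ≤ r < 1`.
    have hb : ∀ k, p k x ≤ r ∧ r - p k x ≤ r ^ k := by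
      intro k
      induction k with
      | zero =>
        change (0 : ℝ) ≤ r ∧ r - 0 ≤ r ^ 0
        rw [pow_zero]
        exact ⟨hr0, by linarith⟩
      | succ k ih =>
        have hk := (hp k).nonneg x
        change 1 / 2 * (m x + p k x ^ 2) ≤ r ∧ r - 1 / 2 * (m x + p k x ^ 2) ≤ r ^ (k + 1)
        rw [pow_succ r k, hmr]
        have h1 : (r - p k x) * r ≤ r ^ k * r := mul_le_mul_of_nonneg_right ih.2 hr0
        have h2 : 0 ≤ (r - p k x) * (r - p k x) := mul_self_nonneg _
        constructor
        · nlinarith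
        · nlinarith
    have ht := tendsto_pow_atTop_nhds_zero_of_lt_one hr0 hr1
    refine tendsto_of_tendsto_of_tendsto_of_le_of_le
      (g := fun k => r - r ^ k) (h := fun _ => r) ?_ tendsto_const_nhds
      (fun k => by have := (hb k).2; change r - r ^ k ≤ p k x; linarith) fun k => (hb k).1
    simpa using ht.const_sub r
  refine (hr.inv_one_sub fun x => ?_).congr fun x => by rw [sub_sub_cancel]
  have : 0 < Real.sqrt (1 - m x) := Real.sqrt_pos.2 (by linarith [h x])
  linarith

/-- Riemann sums of `1/y = ∫₀^∞ e^{-uy} du` at `y = 1 + s x²`: with mesh `h = 1/(k+1)` they equal `h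
/ (1 - e^{-hy})`, a geometric series in a Gaussian, and tend to `1/y` by the derivative of `exp` at
`0`. -/
theorem inv_one_add_mul_sq {s : ℝ} (hs : 0 < s) : GaussMix fun x => (1 + s * x ^ 2)⁻¹ := by
  have hk : ∀ k : ℕ, GaussMix fun x =>
      1 / ((k : ℝ) + 1) * (1 - Real.exp (-(1 / ((k : ℝ) + 1))) *
        Real.exp (-(s / ((k : ℝ) + 1)) * x ^ 2))⁻¹ := by
    intro k
    have hk : (0 : ℝ) < (k : ℝ) + 1 := by positivity
    refine smul _ (by positivity) (inv_one_sub
      (smul _ (Real.exp_pos _).le (gauss _ (by positivity))) fun x => ?_)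
    rw [← Real.exp_add, Real.exp_lt_one_iff]
    have : 0 < 1 / ((k : ℝ) + 1) := by positivity
    have : 0 ≤ s / ((k : ℝ) + 1) * x ^ 2 := by positivity
    linarith
  refine lim hk fun x => ?_
  have hy : 0 < 1 + s * x ^ 2 := by positivity
  have hd : HasDerivAt (fun u : ℝ => 1 - Real.exp (-((1 + s * x ^ 2) * u)))
      (1 + s * x ^ 2) 0 := by
    have h1 : HasDerivAt (fun u : ℝ => -((1 + s * x ^ 2) * u)) (-((1 + s * x ^ 2) * 1)) 0 :=
      ((hasDerivAt_id (0 : ℝ)).const_mul _).neg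
    exact (h1.exp.const_sub 1).congr_deriv (by simp)
  rw [hasDerivAt_iff_tendsto_slope_zero] at hd
  have hseq : Tendsto (fun k : ℕ => 1 / ((k : ℝ) + 1)) atTop (nhdsWithin 0 {0}ᶜ) :=
    tendsto_nhdsWithin_iff.2 ⟨tendsto_one_div_add_atTop_nhds_zero_nat,
      Eventually.of_forall fun k => by
        have : (k : ℝ) + 1 ≠ 0 := by positivity
        simpa using this⟩
  refine ((hd.comp hseq).inv₀ hy.ne').congr fun k => ?_
  simp only [Function.comp, zero_add, mul_zero, neg_zero, Real.exp_zero, sub_self, sub_zero,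
    smul_eq_mul, mul_inv, inv_inv]
  rw [← Real.exp_add]
  congr 4
  ring_nf

end GaussMix

/-- The Mittag-Leffler expansion of the cotangent at `z = i x / π`, where `π z cot (π z) = x coth
x`. -/
theorem tendsto_sum_mul_coth {x : ℝ} (hx : x ≠ 0) :
    Tendsto (fun N : ℕ => 1 + ∑ k ∈ Finset.range N,
      2 * x ^ 2 / (x ^ 2 + ((k : ℝ) + 1) ^ 2 * Real.pi ^ 2)) atTop
      (nhds (x * Real.cosh x / Real.sinh x)) := by
  have hpi : (Real.pi : ℂ) ≠ 0 := by exact_mod_cast Real.pi_ne_zero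
  have hxc : (x : ℂ) ≠ 0 := by exact_mod_cast hx
  set z : ℂ := (x / Real.pi : ℂ) * Complex.I with hzdef
  have hz : z ∈ Complex.integerComplement := by
    rintro ⟨n, hn⟩
    have := congrArg Complex.im hn
    rw [hzdef, ← Complex.ofReal_div, Complex.im_ofReal_mul, Complex.I_im] at this
    have h3 : x / Real.pi ≠ 0 := div_ne_zero hx Real.pi_ne_zero
    exact h3 (by simpa using this.symm)
  have hz2 : z ^ 2 = -(x ^ 2 / Real.pi ^ 2) := by
    rw [hzdef, mul_pow, Complex.I_sq]; ring
  have hz0 : z ≠ 0 := Complex.integerComplement.ne_zero hz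
  have hs : (Complex.sinh x) ≠ 0 := by
    exact_mod_cast Real.sinh_ne_zero.2 hx
  have h := ((tendsto_logDeriv_euler_cot_sub hz).const_mul z).const_add 1
  have hlim : 1 + z * (Real.pi * Complex.cot (Real.pi * z) - 1 / z)
      = ((x * Real.cosh x / Real.sinh x : ℝ) : ℂ) := by
    have hpz : Real.pi * z = x * Complex.I := by rw [hzdef]; field_simp
    rw [mul_sub, ← mul_assoc, mul_comm z, hpz, mul_one_div_cancel hz0, Complex.cot,
      Complex.cos_mul_I, Complex.sin_mul_I]
    push_cast
    field_simp
    ring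
  rw [hlim] at h
  have hre := (Complex.continuous_re.tendsto _).comp h
  rw [Complex.ofReal_re] at hre
  refine hre.congr fun N => ?_
  simp only [Function.comp]
  rw [← Complex.ofReal_re (1 + ∑ k ∈ Finset.range N,
    2 * x ^ 2 / (x ^ 2 + ((k : ℝ) + 1) ^ 2 * Real.pi ^ 2))]
  congr 1
  push_cast
  rw [Finset.mul_sum]
  congr 1
  refine Finset.sum_congr rfl fun k _ => ?_
  have h1 : z + ((k : ℂ) + 1) ≠ 0 := by
    exact_mod_cast Complex.integerComplement_add_ne_zero hz ((k : ℤ) + 1)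
  have h2 : z - ((k : ℂ) + 1) ≠ 0 := by
    have := Complex.integerComplement_add_ne_zero hz (-((k : ℤ) + 1))
    push_cast at this
    rwa [← sub_eq_add_neg] at this
  have h5 : (x : ℂ) ^ 2 = -(z ^ 2 * Real.pi ^ 2) := by rw [hz2]; field_simp
  have h6 : -(z ^ 2 * (Real.pi : ℂ) ^ 2) + ((k : ℂ) + 1) ^ 2 * (Real.pi : ℂ) ^ 2
      = -((z + (k + 1)) * (z - (k + 1)) * (Real.pi : ℂ) ^ 2) := by ring
  rw [h5, h6]
  field_simp
  ring

/-- The function is `(x coth x)^(-1/2)`. With `v k = 1/(1 + x²/((k+1)²π²))`, the partial sums of `x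
coth x` are `1 + ∑ 2(1 - v k) = (2N + 1)(1 - w)`, where `w = 2/(2N+1) ∑ v k` is a Gaussian mixture
below `1`. So `inv_sqrt_one_sub` applies before passing to the limit. -/
theorem gaussMix_whithamSymbol_sq : GaussMix fun x => whithamSymbol (1 / 4) x ^ 2 := by
  let v : ℕ → ℝ → ℝ := fun k x => (1 + (1 / (((k : ℝ) + 1) ^ 2 * Real.pi ^ 2)) * x ^ 2)⁻¹
  have hv : ∀ k, GaussMix (v k) := fun k => GaussMix.inv_one_add_mul_sq (by positivity)
  have hv1 : ∀ k x, v k x ≤ 1 := fun k x => by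
    refine inv_le_one_of_one_le₀ ?_
    have : 0 ≤ (1 / (((k : ℝ) + 1) ^ 2 * Real.pi ^ 2)) * x ^ 2 := by positivity
    linarith
  have hN : ∀ N : ℕ, GaussMix fun x => (Real.sqrt (1 + ∑ k ∈ Finset.range N,
      2 * (1 - v k x)))⁻¹ := by
    intro N
    have hN : (0 : ℝ) < 2 * N + 1 := by positivity
    have hg : GaussMix fun x => 2 / (2 * (N : ℝ) + 1) * ∑ k ∈ Finset.range N, v k x :=
      GaussMix.smul _ (by positivity) (GaussMix.sum hv N)
    have hlt : ∀ x, 2 / (2 * (N : ℝ) + 1) * ∑ k ∈ Finset.range N, v k x < 1 := by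
      intro x
      have : ∑ k ∈ Finset.range N, v k x ≤ N := by
        simpa using Finset.sum_le_sum fun k (_ : k ∈ Finset.range N) => hv1 k x
      rw [div_mul_eq_mul_div, div_lt_one hN]
      linarith
    refine (GaussMix.smul (Real.sqrt (2 * N + 1))⁻¹ (by positivity)
      (hg.inv_sqrt_one_sub hlt)).congr fun x => ?_
    rw [← mul_inv, ← Real.sqrt_mul hN.le]
    congr 2
    rw [← Finset.mul_sum, Finset.sum_sub_distrib]
    simp only [Finset.sum_const, Finset.card_range, nsmul_eq_mul, mul_one]
    field_simp
    ring
  refine GaussMix.lim hN fun x => ?_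
  unfold whithamSymbol
  split_ifs with hx
  · subst hx
    have : ∀ k, v k 0 = 1 := fun k => by simp [v]
    simp [this]
  · obtain ⟨h0, -⟩ := tanh_div_self_mem hx
    have hpos : 0 < x * Real.cosh x / Real.sinh x := by
      have hs : Real.sinh x ≠ 0 := Real.sinh_ne_zero.2 hx
      have hc := Real.cosh_pos x
      have : 0 < x / Real.sinh x := by
        refine lt_of_le_of_ne ?_ (div_ne_zero hx hs).symm
        rcases lt_or_gt_of_ne hx with h | h
        · exact div_nonneg_of_nonpos h.le (Real.sinh_nonpos_iff.2 h.le)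
        · exact div_nonneg h.le (Real.sinh_nonneg_iff.2 h.le)
      calc 0 < x / Real.sinh x * Real.cosh x := by positivity
        _ = _ := by ring
    have hval : ((Real.tanh x / x) ^ (1 / 4 : ℝ)) ^ 2
        = (Real.sqrt (x * Real.cosh x / Real.sinh x))⁻¹ := by
      rw [← Real.rpow_natCast, ← Real.rpow_mul h0, ← Real.sqrt_inv, Real.sqrt_eq_rpow]
      congr 1
      · rw [Real.tanh_eq_sinh_div_cosh, inv_div]
        field_simp
      · norm_num
    rw [hval]
    refine ((Real.continuous_sqrt.tendsto _).comp (tendsto_sum_mul_coth hx)).inv₀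
      (Real.sqrt_pos.2 hpos).ne' |>.congr fun N => ?_
    simp only [Function.comp]
    congr 3
    refine Finset.sum_congr rfl fun k _ => ?_
    have hp := Real.pi_pos
    have : 0 < x ^ 2 + ((k : ℝ) + 1) ^ 2 * Real.pi ^ 2 := by positivity
    simp only [v]
    field_simp
    ring

/-! ### Plancherel's theorem and quadratic forms of Fourier multipliers. -/

section Plancherel

theorem integral_fourier_mul {f g : ℝ → ℂ} (hf : Integrable f) (hg : Integrable g) :
    ∫ w, 𝓕 f w * g w = ∫ x, f x * 𝓕 g x := by
  have h := VectorFourier.integral_fourierIntegral_smul_eq_flip (μ := volume) (ν := volume)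
    (L := innerₗ ℝ) Real.continuous_fourierChar continuous_inner hf hg
  rw [flip_innerₗ] at h
  exact h

theorem continuous_fourier {f : ℝ → ℂ} (hf : Integrable f) : Continuous (𝓕 f) :=
  VectorFourier.fourierIntegral_continuous Real.continuous_fourierChar
    (innerSL ℝ).continuous₂ hf

/-- On `L¹ ∩ L²` the Fourier transform of `L²` is given by the Fourier integral. -/
theorem coeFn_fourier_toLp {f : ℝ → ℂ} (h1 : Integrable f) (h2 : MemLp f 2) :
    ((𝓕 h2.toLp : Lp ℂ 2 (volume : Measure ℝ)) : ℝ → ℂ) =ᵐ[volume] 𝓕 f := by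
  refine ae_eq_of_integral_contDiff_smul_eq
    ((Lp.memLp (𝓕 h2.toLp : Lp ℂ 2 (volume : Measure ℝ))).locallyIntegrable (by norm_num))
    (continuous_fourier h1).locallyIntegrable fun g hg hgs => ?_
  have hg' : HasCompactSupport fun x => (g x : ℂ) := hgs.comp_left Complex.ofReal_zero
  let G : SchwartzMap ℝ ℂ := hg'.toSchwartzMap (Complex.ofRealCLM.contDiff.comp hg)
  have hG : ∀ x, G x = g x := fun x => rfl
  have h := congrArg (fun T => T G) (Lp.fourier_toTemperedDistribution_eq h2.toLp)
  simp only [TemperedDistribution.fourier_apply, Lp.toTemperedDistribution_apply, hG,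
    smul_eq_mul] at h
  simp only [Complex.real_smul]
  rw [← h]
  have h3 := integral_fourier_mul h1 G.integrable
  calc ∫ x, (𝓕 G) x * (h2.toLp : ℝ → ℂ) x = ∫ x, f x * 𝓕 (G : ℝ → ℂ) x := by
        refine integral_congr_ae ?_
        filter_upwards [h2.coeFn_toLp] with x hx
        rw [hx, SchwartzMap.fourier_coe, mul_comm]
    _ = ∫ w, (g w : ℂ) * 𝓕 f w := by
        rw [← h3]
        exact integral_congr_ae (Eventually.of_forall fun w => by simp only [hG]; ring)

theorem norm_toLp_sq {f : ℝ → ℂ} (h2 : MemLp f 2) : ‖h2.toLp‖ ^ 2 = ∫ x, ‖f x‖ ^ 2 := by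
  rw [Lp.norm_toLp, h2.eLpNorm_eq_integral_rpow_norm (by norm_num) (by norm_num)]
  have h0 : 0 ≤ ∫ x, ‖f x‖ ^ 2 := integral_nonneg fun x => by positivity
  simp only [ENNReal.toReal_ofNat, Real.rpow_ofNat]
  rw [ENNReal.toReal_ofReal (Real.rpow_nonneg h0 _), ← Real.rpow_natCast, ← Real.rpow_mul h0]
  norm_num

theorem memLp_two_fourier {f : ℝ → ℂ} (h1 : Integrable f) (h2 : MemLp f 2) :
    MemLp (𝓕 f) 2 :=
  (memLp_congr_ae (coeFn_fourier_toLp h1 h2)).1 (Lp.memLp _)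

theorem integral_norm_fourier_sq {f : ℝ → ℂ} (h1 : Integrable f) (h2 : MemLp f 2) :
    ∫ w, ‖𝓕 f w‖ ^ 2 = ∫ x, ‖f x‖ ^ 2 := by
  rw [← norm_toLp_sq h2, ← Lp.norm_fourier_eq, ← norm_toLp_sq (memLp_two_fourier h1 h2)]
  congr 2
  exact (Lp.ext ((MemLp.coeFn_toLp _).trans (coeFn_fourier_toLp h1 h2).symm))

end Plancherel

/-- The quadratic form of the Fourier multiplier with symbol `m`. -/
noncomputable def symbolEnergy (m : ℝ → ℝ) (f : ℝ → ℝ) : ℝ :=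
  ∫ w, m (2 * Real.pi * w) * ‖𝓕 (fun x => (f x : ℂ)) w‖ ^ 2

theorem integrable_norm_fourier_sq {f : ℝ → ℝ} (h1 : Integrable f) (h2 : MemLp f 2) :
    Integrable fun w => ‖𝓕 (fun x => (f x : ℂ)) w‖ ^ 2 :=
  (memLp_two_fourier h1.ofReal h2.ofReal).integrable_norm_pow (by norm_num)

theorem integral_norm_fourier_ofReal_sq {f : ℝ → ℝ} (h1 : Integrable f) (h2 : MemLp f 2) :
    ∫ w, ‖𝓕 (fun x => (f x : ℂ)) w‖ ^ 2 = ∫ x, f x ^ 2 := by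
  have := integral_norm_fourier_sq h1.ofReal h2.ofReal
  simpa using this

theorem dispersiveEnergy_sq {f : ℝ → ℝ} (h1 : Integrable f) (h2 : MemLp f 2) :
    dispersiveEnergy f ^ 2 = symbolEnergy (fun x => whithamSymbol (1 / 4) x ^ 2) f := by
  have hf : MemLp (fun x => (f x : ℂ)) 2 (volume : Measure ℝ) := h2.ofReal
  rw [dispersiveEnergy, dif_pos hf, whithamConv, ← Lp.norm_fourier_eq,
    FourierTransform.fourier_fourierInv_eq, norm_toLp_sq]
  refine integral_congr_ae ?_
  filter_upwards [coeFn_fourier_toLp h1.ofReal hf] with w hw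
  have hw' : (𝓕 hf.toLp : Lp ℂ 2 (volume : Measure ℝ)) w = 𝓕 (fun x => (f x : ℂ)) w := hw
  rw [hw', norm_mul, mul_pow, Complex.norm_real, Real.norm_eq_abs, sq_abs]

theorem dispersiveEnergy_nonneg (f : ℝ → ℝ) : 0 ≤ dispersiveEnergy f := by
  unfold dispersiveEnergy
  split_ifs
  · exact norm_nonneg _
  · exact le_rfl

namespace GaussMix

theorem integrable_energy {m : ℝ → ℝ} (hm : GaussMix m) {f : ℝ → ℝ} (h1 : Integrable f)
    (h2 : MemLp f 2) :
    Integrable fun w => m (2 * Real.pi * w) * ‖𝓕 (fun x => (f x : ℂ)) w‖ ^ 2 := by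
  refine (integrable_norm_fourier_sq h1 h2).bdd_mul (c := m 0)
    (hm.measurable.comp (measurable_const.mul measurable_id)).aestronglyMeasurable
    (Eventually.of_forall fun w => ?_)
  rw [Real.norm_eq_abs, abs_of_nonneg (hm.nonneg _)]
  exact hm.le_apply_zero _

theorem energy_le {m : ℝ → ℝ} (hm : GaussMix m) {f : ℝ → ℝ} (h1 : Integrable f)
    (h2 : MemLp f 2) : symbolEnergy m f ≤ m 0 * ∫ x, f x ^ 2 := by
  rw [← integral_norm_fourier_ofReal_sq h1 h2, ← integral_const_mul]
  refine integral_mono (hm.integrable_energy h1 h2)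
    ((integrable_norm_fourier_sq h1 h2).const_mul _) fun w => ?_
  exact mul_le_mul_of_nonneg_right (hm.le_apply_zero _) (by positivity)

/-- An energy inequality for all Gaussian symbols passes to all Gaussian mixtures. -/
theorem energy_sub_le {m : ℝ → ℝ} (hm : GaussMix m) {f g : ℝ → ℝ} (hf1 : Integrable f)
    (hf2 : MemLp f 2) (hg1 : Integrable g) (hg2 : MemLp g 2) {κ : ℝ}
    (h : ∀ t : ℝ, 0 < t → symbolEnergy (fun x => Real.exp (-t * x ^ 2)) f
      - symbolEnergy (fun x => Real.exp (-t * x ^ 2)) g ≤ κ) :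
    symbolEnergy m f - symbolEnergy m g ≤ κ * m 0 := by
  induction hm with
  | gauss t ht => simpa using h t ht
  | @smul m c hc hm ih =>
    have e : ∀ f, symbolEnergy (fun x => c * m x) f = c * symbolEnergy m f := fun f => by
      simp only [symbolEnergy, mul_assoc, integral_const_mul]
    rw [e, e]
    nlinarith
  | @add m n hm hn ih1 ih2 =>
    have e : ∀ f, Integrable f → MemLp f 2 →
        symbolEnergy (fun x => m x + n x) f = symbolEnergy m f + symbolEnergy n f := by
      intro f h1 h2
      simp only [symbolEnergy, add_mul]
      exact integral_add (hm.integrable_energy h1 h2) (hn.integrable_energy h1 h2)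
    rw [e f hf1 hf2, e g hg1 hg2]
    linarith
  | @lim m n hm hlim ih =>
    -- Mixtures are largest at `0`, so convergence at this one point supplies the dominating
    -- constant.
    obtain ⟨C, hC⟩ := (hlim 0).bddAbove_range
    have e : ∀ f, Integrable f → MemLp f 2 →
        Tendsto (fun k => symbolEnergy (m k) f) atTop (nhds (symbolEnergy n f)) := by
      intro f h1 h2
      refine tendsto_integral_of_dominated_convergence
        (fun w => C * ‖𝓕 (fun x => (f x : ℂ)) w‖ ^ 2)
        (fun k => ((hm k).integrable_energy h1 h2).aestronglyMeasurable)
        ((integrable_norm_fourier_sq h1 h2).const_mul C) (fun k => ?_) ?_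
      · refine Eventually.of_forall fun w => ?_
        rw [Real.norm_eq_abs, abs_of_nonneg (mul_nonneg ((hm k).nonneg _) (by positivity))]
        exact mul_le_mul_of_nonneg_right
          (((hm k).le_apply_zero _).trans (hC ⟨k, rfl⟩)) (by positivity)
      · exact Eventually.of_forall fun w => (hlim _).mul_const _
    exact le_of_tendsto_of_tendsto' ((e f hf1 hf2).sub (e g hg1 hg2))
      ((hlim 0).const_mul κ) ih

end GaussMix

theorem fourier_comp_div {u : ℝ} (hu : 0 < u) (f : ℝ → ℂ) (w : ℝ) :
    𝓕 (fun x => f (x / u)) w = u * 𝓕 f (u * w) := by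
  rw [Real.fourier_real_eq, Real.fourier_real_eq]
  have := Measure.integral_comp_div
    (fun x : ℝ => Real.fourierChar (-(x * (u * w))) • f x) u
  rw [abs_of_pos hu, Complex.real_smul] at this
  rw [← this]
  congr 1
  ext x
  congr 3
  field_simp

theorem symbolEnergy_comp_div {u : ℝ} (hu : 0 < u) (m f : ℝ → ℝ) :
    symbolEnergy m (fun x => f (x / u)) = u * symbolEnergy (fun x => m (x / u)) f := by
  unfold symbolEnergy
  have := Measure.integral_comp_div (fun w : ℝ => u ^ 2 *
    (m (2 * Real.pi * (w / u)) * ‖𝓕 (fun x => (f x : ℂ)) w‖ ^ 2)) u⁻¹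
  rw [abs_of_pos (inv_pos.2 hu)] at this
  have e : u * ∫ w, m (2 * Real.pi * w / u) * ‖𝓕 (fun x => (f x : ℂ)) w‖ ^ 2
      = u⁻¹ • ∫ w, u ^ 2 *
          (m (2 * Real.pi * (w / u)) * ‖𝓕 (fun x => (f x : ℂ)) w‖ ^ 2) := by
    rw [smul_eq_mul, integral_const_mul]
    simp only [mul_div_assoc]
    field_simp
  rw [e, ← this]
  congr 1
  ext w
  rw [fourier_comp_div hu (fun x => (f x : ℂ)), norm_mul, mul_pow, Complex.norm_real,
    Real.norm_eq_abs, sq_abs, div_inv_eq_mul, mul_comm w u, mul_div_cancel_left₀ _ hu.ne']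
  ring

/-- Dilation by `u ≥ 1` moves frequencies towards `0`, where a mixture is larger. The energy thus
grows at least as fast as the modular, which scales exactly by `u`. -/
theorem GaussMix.mul_energy_le_comp_div {m : ℝ → ℝ} (hm : GaussMix m) {u : ℝ} (hu : 1 ≤ u)
    {f : ℝ → ℝ} (h1 : Integrable f) (h2 : MemLp f 2) :
    u * symbolEnergy m f ≤ symbolEnergy m (fun x => f (x / u)) := by
  have hu0 : 0 < u := by linarith
  rw [symbolEnergy_comp_div hu0]
  refine mul_le_mul_of_nonneg_left ?_ hu0.le
  refine integral_mono (hm.integrable_energy h1 h2) ?_ fun w => ?_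
  · refine (integrable_norm_fourier_sq h1 h2).bdd_mul (c := m 0)
      (hm.measurable.comp (by fun_prop)).aestronglyMeasurable
      (Eventually.of_forall fun w => ?_)
    change |m (2 * Real.pi * w / u)| ≤ m 0
    rw [abs_of_nonneg (hm.nonneg _)]
    exact hm.le_apply_zero _
  · refine mul_le_mul_of_nonneg_right (hm.anti ?_) (by positivity)
    rw [abs_div, abs_of_pos hu0]
    exact div_le_self (abs_nonneg _) hu

theorem GaussMix.tendsto_energy_comp_div {m : ℝ → ℝ} (hm : GaussMix m)
    (hc : ContinuousAt m 0) {f : ℝ → ℝ} (h1 : Integrable f) (h2 : MemLp f 2) {u : ℕ → ℝ}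
    (hu : Tendsto u atTop atTop) :
    Tendsto (fun k => symbolEnergy (fun x => m (x / u k)) f) atTop
      (nhds (m 0 * ∫ x, f x ^ 2)) := by
  rw [← integral_norm_fourier_ofReal_sq h1 h2, ← integral_const_mul]
  refine tendsto_integral_of_dominated_convergence
    (fun w => m 0 * ‖𝓕 (fun x => (f x : ℂ)) w‖ ^ 2) (fun k => ?_)
    ((integrable_norm_fourier_sq h1 h2).const_mul _) (fun k => ?_) ?_
  · exact (hm.measurable.comp (by fun_prop)).aestronglyMeasurable.mul
      (integrable_norm_fourier_sq h1 h2).aestronglyMeasurable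
  · refine Eventually.of_forall fun w => ?_
    rw [Real.norm_eq_abs, abs_of_nonneg (mul_nonneg (hm.nonneg _) (by positivity))]
    exact mul_le_mul_of_nonneg_right (hm.le_apply_zero _) (by positivity)
  · refine Eventually.of_forall fun w => Tendsto.mul_const _ ?_
    exact hc.tendsto.comp (hu.const_div_atTop _)

/-! ### Convolution energies and Dirichlet forms. -/

/-- Even, radially nonincreasing probability densities on the line. -/
structure IsBumpKernel (k : ℝ → ℝ) : Prop where
  nonneg : ∀ x, 0 ≤ k x
  measurable : Measurable k
  integrable : Integrable k
  integral_eq_one : ∫ x, k x = 1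
  anti : ∀ x y, |x| ≤ |y| → k y ≤ k x

/-- The quadratic form of the convolution with `k`. -/
noncomputable def kernelEnergy (k f : ℝ → ℝ) : ℝ :=
  ∫ p : ℝ × ℝ, k (p.1 - p.2) * (f p.1 * f p.2)

namespace IsBumpKernel

variable {k f g : ℝ → ℝ}

theorem neg (hk : IsBumpKernel k) (x : ℝ) : k (-x) = k x :=
  le_antisymm (hk.anti _ _ (by simp)) (hk.anti _ _ (by simp))

theorem integrable_snd (hk : IsBumpKernel k) (hf : Integrable f) :
    Integrable (fun p : ℝ × ℝ => k (p.1 - p.2) * f p.2) := by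
  have := Integrable.convolution_integrand (μ := volume) (ν := volume)
    (ContinuousLinearMap.mul ℝ ℝ) hf hk.integrable
  refine this.congr (Eventually.of_forall fun p => ?_)
  simp [mul_comm]

theorem integrable_fst (hk : IsBumpKernel k) (hf : Integrable f) :
    Integrable (fun p : ℝ × ℝ => k (p.1 - p.2) * f p.1) := by
  refine (hk.integrable_snd hf).swap.congr (Eventually.of_forall fun p => ?_)
  simp only [Function.comp, Prod.fst_swap, Prod.snd_swap]
  rw [← hk.neg, neg_sub]

theorem integral_fst (hk : IsBumpKernel k) (hf : Integrable f) :
    ∫ p : ℝ × ℝ, k (p.1 - p.2) * f p.1 = ∫ x, f x := by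
  have h := integral_prod _ (hk.integrable_fst hf)
  rw [Measure.volume_eq_prod, h]
  refine integral_congr_ae (Eventually.of_forall fun x => ?_)
  simp only [integral_mul_const]
  rw [integral_sub_left_eq_self k volume x, hk.integral_eq_one, one_mul]

theorem integral_snd (hk : IsBumpKernel k) (hf : Integrable f) :
    ∫ p : ℝ × ℝ, k (p.1 - p.2) * f p.2 = ∫ x, f x := by
  rw [← hk.integral_fst hf, Measure.volume_eq_prod,
    ← integral_prod_swap (fun p : ℝ × ℝ => k (p.1 - p.2) * f p.1)]
  refine integral_congr_ae (Eventually.of_forall fun p => ?_)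
  simp only [Prod.fst_swap, Prod.snd_swap]
  rw [← hk.neg, neg_sub]

theorem measurable_sub (hk : IsBumpKernel k) : Measurable fun p : ℝ × ℝ => k (p.1 - p.2) :=
  hk.measurable.comp (measurable_fst.sub measurable_snd)

theorem integrable_energy (hk : IsBumpKernel k) (hm : Measurable f) (hf : MemLp f 2) :
    Integrable (fun p : ℝ × ℝ => k (p.1 - p.2) * (f p.1 * f p.2)) := by
  refine ((hk.integrable_fst hf.integrable_sq).add (hk.integrable_snd hf.integrable_sq)).mono'
    (hk.measurable_sub.mul
      ((hm.comp measurable_fst).mul (hm.comp measurable_snd))).aestronglyMeasurable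
    (Eventually.of_forall fun p => ?_)
  rw [Real.norm_eq_abs, abs_mul, abs_of_nonneg (hk.nonneg _)]
  simp only [Pi.add_apply]
  rw [← mul_add]
  refine mul_le_mul_of_nonneg_left ?_ (hk.nonneg _)
  rw [abs_le]
  constructor <;> nlinarith [sq_nonneg (f p.1 + f p.2), sq_nonneg (f p.1 - f p.2),
    sq_nonneg (f p.1), sq_nonneg (f p.2)]

theorem dirichlet_eq (f : ℝ → ℝ) (p : ℝ × ℝ) : k (p.1 - p.2) * (f p.1 - f p.2) ^ 2
    = k (p.1 - p.2) * f p.1 ^ 2 + k (p.1 - p.2) * f p.2 ^ 2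
      - 2 * (k (p.1 - p.2) * (f p.1 * f p.2)) := by ring

theorem integrable_dirichlet (hk : IsBumpKernel k) (hm : Measurable f) (hf : MemLp f 2) :
    Integrable (fun p : ℝ × ℝ => k (p.1 - p.2) * (f p.1 - f p.2) ^ 2) := by
  simp only [dirichlet_eq]
  exact ((hk.integrable_fst hf.integrable_sq).add (hk.integrable_snd hf.integrable_sq)).sub
    ((hk.integrable_energy hm hf).const_mul 2)

theorem integral_dirichlet (hk : IsBumpKernel k) (hm : Measurable f) (hf : MemLp f 2) :
    ∫ p : ℝ × ℝ, k (p.1 - p.2) * (f p.1 - f p.2) ^ 2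
      = 2 * ((∫ x, f x ^ 2) - kernelEnergy k f) := by
  simp only [dirichlet_eq]
  have h := integral_sub ((hk.integrable_fst hf.integrable_sq).add
    (hk.integrable_snd hf.integrable_sq)) ((hk.integrable_energy hm hf).const_mul 2)
  simp only [Pi.add_apply] at h
  rw [h, integral_add (hk.integrable_fst hf.integrable_sq) (hk.integrable_snd hf.integrable_sq),
    hk.integral_fst hf.integrable_sq, hk.integral_snd hf.integrable_sq, integral_const_mul,
    kernelEnergy]
  ring

/-- The Dirichlet form `‖f‖² - ⟨k ∗ f, f⟩` decreases under contractions. -/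
theorem energy_sub_le_of_contraction (hk : IsBumpKernel k) (hfm : Measurable f)
    (hf : MemLp f 2) (hgm : Measurable g) (hg : MemLp g 2)
    (h : ∀ x y, |g x - g y| ≤ |f x - f y|) :
    kernelEnergy k f - kernelEnergy k g ≤ (∫ x, f x ^ 2) - ∫ x, g x ^ 2 := by
  have := integral_mono (hk.integrable_dirichlet hgm hg) (hk.integrable_dirichlet hfm hf)
    fun p => mul_le_mul_of_nonneg_left (sq_le_sq.2 (h p.1 p.2)) (hk.nonneg _)
  rw [hk.integral_dirichlet hgm hg, hk.integral_dirichlet hfm hf] at this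
  linarith

/-- With nonnegative extended integrals, the later changes of variable and monotonicity arguments
need no integrability. -/
theorem lintegral_dirichlet (hk : IsBumpKernel k) (hm : Measurable f) (hf : MemLp f 2) :
    ∫⁻ x, ∫⁻ y, ENNReal.ofReal (k (x - y) * (f x - f y) ^ 2)
      = ENNReal.ofReal (2 * ((∫ x, f x ^ 2) - kernelEnergy k f)) := by
  rw [← hk.integral_dirichlet hm hf, ofReal_integral_eq_lintegral_ofReal
    (hk.integrable_dirichlet hm hf)
    (Eventually.of_forall fun p => mul_nonneg (hk.nonneg _) (sq_nonneg _)),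
    Measure.volume_eq_prod, lintegral_prod]
  exact (hk.measurable_sub.mul (((hm.comp measurable_fst).sub
    (hm.comp measurable_snd)).pow_const 2)).ennreal_ofReal.aemeasurable

theorem lintegral_energy (hk : IsBumpKernel k) (hm : Measurable f) (hf : MemLp f 2)
    (h0 : ∀ x, 0 ≤ f x) :
    ∫⁻ x, ∫⁻ y, ENNReal.ofReal (k (x - y) * (f x * f y))
      = ENNReal.ofReal (kernelEnergy k f) := by
  rw [kernelEnergy, ofReal_integral_eq_lintegral_ofReal (hk.integrable_energy hm hf)
    (Eventually.of_forall fun p => mul_nonneg (hk.nonneg _) (mul_nonneg (h0 _) (h0 _))),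
    Measure.volume_eq_prod, lintegral_prod]
  exact (hk.measurable_sub.mul ((hm.comp measurable_fst).mul
    (hm.comp measurable_snd))).ennreal_ofReal.aemeasurable

theorem dirichlet_nonneg (hk : IsBumpKernel k) (hm : Measurable f) (hf : MemLp f 2) :
    0 ≤ 2 * ((∫ x, f x ^ 2) - kernelEnergy k f) := by
  rw [← hk.integral_dirichlet hm hf]
  exact integral_nonneg fun p => mul_nonneg (hk.nonneg _) (sq_nonneg _)

theorem energy_nonneg (hk : IsBumpKernel k) (h0 : ∀ x, 0 ≤ f x) : 0 ≤ kernelEnergy k f :=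
  integral_nonneg fun _ => mul_nonneg (hk.nonneg _) (mul_nonneg (h0 _) (h0 _))

end IsBumpKernel

/-- The Fourier transform of the Gaussian symbol `exp (-t ξ²)`, `ξ = 2 π w`. -/
noncomputable def gaussKernel (t x : ℝ) : ℝ :=
  (Real.sqrt (4 * Real.pi * t))⁻¹ * Real.exp (-(1 / (4 * t)) * x ^ 2)

theorem isBumpKernel_gaussKernel {t : ℝ} (ht : 0 < t) : IsBumpKernel (gaussKernel t) where
  nonneg x := by unfold gaussKernel; positivity
  measurable := by unfold gaussKernel; fun_prop
  integrable := (integrable_exp_neg_mul_sq (by positivity)).const_mul _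
  integral_eq_one := by
    unfold gaussKernel
    rw [integral_const_mul, integral_gaussian, inv_mul_eq_one₀ (by positivity)]
    congr 1
    field_simp
  anti x y h := by
    unfold gaussKernel
    have := sq_le_sq.2 h
    gcongr _ * Real.exp ?_
    have : 0 < 1 / (4 * t) := by positivity
    nlinarith

theorem fourier_gauss_symbol {t : ℝ} (ht : 0 < t) (x : ℝ) :
    𝓕 (fun w : ℝ => ((Real.exp (-t * (2 * Real.pi * w) ^ 2) : ℝ) : ℂ)) x
      = (gaussKernel t x : ℂ) := by
  have hpi := Real.pi_pos
  have hb : 0 < ((4 * Real.pi * t : ℝ) : ℂ).re := by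
    rw [Complex.ofReal_re]; positivity
  have h := congrFun (fourier_gaussian_pi hb) x
  have e : (fun w : ℝ => ((Real.exp (-t * (2 * Real.pi * w) ^ 2) : ℝ) : ℂ))
      = fun w : ℝ => Complex.exp (-Real.pi * ((4 * Real.pi * t : ℝ) : ℂ) * w ^ 2) := by
    ext w
    push_cast
    congr 1
    ring
  rw [e, h, gaussKernel, Real.sqrt_eq_rpow]
  push_cast
  rw [Complex.ofReal_cpow (by positivity)]
  push_cast
  rw [one_div]
  congr 2
  have : (t : ℂ) ≠ 0 := by exact_mod_cast ht.ne'
  have : (Real.pi : ℂ) ≠ 0 := by exact_mod_cast hpi.ne'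
  field_simp

/-- The multiplication formula `∫ 𝓕f · g = ∫ f · 𝓕g` is applied to `g = conj (𝓕f) · γ`. Its
transform is the convolution of `f` with the heat kernel (`hinner`), by the same formula for the
modulated Gaussian. -/
theorem symbolEnergy_gauss {t : ℝ} (ht : 0 < t) {f : ℝ → ℝ} (hm : Measurable f)
    (h1 : Integrable f) (h2 : MemLp f 2) :
    symbolEnergy (fun x => Real.exp (-t * x ^ 2)) f = kernelEnergy (gaussKernel t) f := by
  have hk := isBumpKernel_gaussKernel ht
  set F : ℝ → ℂ := 𝓕 (fun x => (f x : ℂ)) with hF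
  set γ : ℝ → ℝ := fun w => Real.exp (-t * (2 * Real.pi * w) ^ 2) with hγ
  have hfi : Integrable fun x => (f x : ℂ) := h1.ofReal
  have hFc : Continuous F := continuous_fourier hfi
  have hFb : ∀ w, ‖F w‖ ≤ ∫ x, ‖(f x : ℂ)‖ :=
    VectorFourier.norm_fourierIntegral_le_integral_norm _ _ _ _
  have hγi : Integrable γ := by
    have hpi := Real.pi_pos
    have := integrable_exp_neg_mul_sq (b := t * (2 * Real.pi) ^ 2) (by positivity)
    refine this.congr (Eventually.of_forall fun w => ?_)
    simp only [hγ]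
    congr 1
    ring
  have hγF : Integrable fun w => (starRingEnd ℂ) (F w) * (γ w : ℂ) :=
    hγi.ofReal.bdd_mul (c := ∫ x, ‖(f x : ℂ)‖)
      (Complex.continuous_conj.comp hFc).aestronglyMeasurable
      (Eventually.of_forall fun w => by rw [RCLike.norm_conj]; exact hFb w)
  have hmod : ∀ x : ℝ, Integrable fun w : ℝ => (Real.fourierChar (w * x) : ℂ) * (γ w : ℂ) :=
    fun x => hγi.ofReal.bdd_mul (c := 1)
      (by fun_prop) (Eventually.of_forall fun w => (Circle.norm_coe _).le)
  have hinner : ∀ x, 𝓕 (fun w => (starRingEnd ℂ) (F w) * (γ w : ℂ)) x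
      = ((∫ y, gaussKernel t (x - y) * f y : ℝ) : ℂ) := by
    intro x
    rw [← Complex.conj_ofReal, ← (starRingEnd_self_apply
      (𝓕 (fun w => (starRingEnd ℂ) (F w) * (γ w : ℂ)) x))]
    congr 1
    rw [Real.fourier_real_eq, ← integral_conj]
    have h3 := integral_fourier_mul hfi (hmod x)
    have h4 : ∀ y, 𝓕 (fun w : ℝ => (Real.fourierChar (w * x) : ℂ) * (γ w : ℂ)) y
        = (gaussKernel t (x - y) : ℂ) := by
      intro y
      rw [← hk.neg, neg_sub, ← fourier_gauss_symbol ht, Real.fourier_real_eq,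
        Real.fourier_real_eq]
      congr 1
      ext w
      rw [Circle.smul_def, Circle.smul_def, smul_eq_mul, smul_eq_mul, ← mul_assoc,
        ← Circle.coe_mul, ← AddChar.map_add_eq_mul]
      congr 4
      ring
    simp only [h4] at h3
    rw [← integral_complex_ofReal]
    calc _ = ∫ w, F w * ((Real.fourierChar (w * x) : ℂ) * (γ w : ℂ)) := by
          congr 1
          ext w
          rw [Circle.smul_def, smul_eq_mul, map_mul, map_mul, starRingEnd_self_apply,
            Complex.conj_ofReal, ← Circle.coe_inv_eq_conj, ← AddChar.map_neg_eq_inv, neg_neg]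
          ring
      _ = _ := by
          refine h3.trans ?_
          congr 1
          ext y
          push_cast
          ring
  have hmain := integral_fourier_mul hfi hγF
  simp only [hinner] at hmain
  have hprod := integral_prod _ (hk.integrable_energy hm h2)
  rw [kernelEnergy, Measure.volume_eq_prod, hprod]
  apply Complex.ofReal_injective
  rw [symbolEnergy, ← integral_complex_ofReal, ← integral_complex_ofReal]
  calc _ = ∫ w, F w * ((starRingEnd ℂ) (F w) * (γ w : ℂ)) := by
        congr 1
        ext w
        rw [← mul_assoc, Complex.mul_conj, Complex.normSq_eq_norm_sq, mul_comm,
          Complex.ofReal_mul]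
    _ = _ := by
        refine hmain.trans ?_
        congr 1
        ext x
        rw [← Complex.ofReal_mul, ← integral_const_mul]
        congr 2
        ext y
        ring

/-! ### Reparametrisations of the line. -/

/-- `ψ` is the change of variable on the line that transports Lebesgue measure to `p dx`. -/
structure IsReparam (p ψ : ℝ → ℝ) : Prop where
  measurable_density : Measurable p
  density_pos : ∀ x, 0 < p x
  locallyIntegrable : LocallyIntegrable p
  measurable : Measurable ψ
  map_eq : Measure.map ψ volume = volume.withDensity fun x => ENNReal.ofReal (p x)
  abs_sub : ∀ t s, |t - s| = |∫ x in ψ s..ψ t, p x|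
  map_zero : ψ 0 = 0

/-- `ψ` is the inverse of the primitive of `p`, a bijection because `p ≥ c > 0`. As `p` need not be
continuous, the image measure is identified on half-open intervals instead of by differentiating
`ψ`. -/
theorem exists_isReparam {p : ℝ → ℝ} (hp : Measurable p) {c : ℝ} (hc : 0 < c)
    (hpc : ∀ x, c ≤ p x) (hloc : LocallyIntegrable p) : ∃ ψ, IsReparam p ψ := by
  have hint : ∀ a b, IntervalIntegrable p volume a b := fun a b =>
    (hloc.integrableOn_isCompact isCompact_uIcc).intervalIntegrable
  set φ : ℝ → ℝ := fun x => ∫ s in (0 : ℝ)..x, p s with hφ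
  have hsub : ∀ x y, φ y - φ x = ∫ s in x..y, p s := fun x y =>
    intervalIntegral.integral_interval_sub_left (hint 0 y) (hint 0 x)
  have hlow : ∀ x y, x ≤ y → c * (y - x) ≤ φ y - φ x := by
    intro x y hxy
    rw [hsub]
    have := intervalIntegral.integral_mono_on hxy (intervalIntegrable_const (c := c)) (hint x y)
      fun s _ => hpc s
    simpa [mul_comm] using this
  have hmono : StrictMono φ := fun x y hxy => by
    have := hlow x y hxy.le
    nlinarith [mul_pos hc (sub_pos.2 hxy)]
  have hcont : Continuous φ := intervalIntegral.continuous_primitive hint 0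
  have h0 : φ 0 = 0 := by simp [hφ]
  have hsurj : Function.Surjective φ := by
    refine hcont.surjective ?_ ?_
    · refine tendsto_atTop_mono' atTop ?_ (tendsto_id.const_mul_atTop hc)
      filter_upwards [eventually_ge_atTop 0] with x hx
      have := hlow 0 x hx
      simp only [id]
      linarith
    · refine tendsto_atBot_mono' atBot ?_ (tendsto_id.const_mul_atBot hc)
      filter_upwards [eventually_le_atBot 0] with x hx
      have := hlow x 0 hx
      simp only [id]
      linarith
  set e := hmono.orderIsoOfSurjective φ hsurj with he
  have hφe : ∀ x, φ (e.symm x) = x := fun x => e.apply_symm_apply x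
  refine ⟨e.symm, hp, fun x => hc.trans_le (hpc x), hloc,
    e.symm.continuous.measurable, ?_, fun t s => ?_, ?_⟩
  · have hv : ∀ a b, a < b → Measure.map e.symm volume (Ioc a b)
        = ENNReal.ofReal (φ b - φ a) := by
      intro a b hab
      rw [Measure.map_apply e.symm.continuous.measurable measurableSet_Ioc]
      have : e.symm ⁻¹' Ioc a b = Ioc (φ a) (φ b) := by
        ext x
        simp only [mem_preimage, mem_Ioc]
        rw [← hmono.lt_iff_lt, ← hmono.le_iff_le (a := e.symm x), hφe]
      rw [this, Real.volume_Ioc]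
    refine Measure.ext_of_Ioc' _ _ (fun a b hab => ?_) fun a b hab => ?_
    · rw [hv a b hab]; exact ENNReal.ofReal_ne_top
    · rw [hv a b hab, withDensity_apply _ measurableSet_Ioc, hsub,
        intervalIntegral.integral_of_le hab.le, ofReal_integral_eq_lintegral_ofReal
          ((hint a b).1) (Eventually.of_forall fun x => (hc.trans_le (hpc x)).le)]
  · rw [← hsub, hφe, hφe]
  · have := e.symm_apply_apply 0
    rwa [show e 0 = 0 from h0] at this

namespace IsReparam

variable {p ψ : ℝ → ℝ}

theorem lintegral_comp (h : IsReparam p ψ) {G : ℝ → ℝ≥0∞} (hG : Measurable G) :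
    ∫⁻ t, G (ψ t) = ∫⁻ x, ENNReal.ofReal (p x) * G x := by
  rw [← lintegral_map hG h.measurable, h.map_eq,
    lintegral_withDensity_eq_lintegral_mul _ h.measurable_density.ennreal_ofReal hG]
  rfl

theorem lintegral_lintegral_comp (h : IsReparam p ψ) {G : ℝ → ℝ → ℝ≥0∞}
    (hG : Measurable (Function.uncurry G)) :
    ∫⁻ t, ∫⁻ s, G (ψ t) (ψ s)
      = ∫⁻ x, ∫⁻ y, ENNReal.ofReal (p x) * (ENNReal.ofReal (p y) * G x y) := by
  have hp := h.measurable_density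
  have h1 : ∀ x, ∫⁻ s, G x (ψ s) = ∫⁻ y, ENNReal.ofReal (p y) * G x y := fun x =>
    h.lintegral_comp (hG.comp measurable_prodMk_left)
  simp only [h1]
  have hm : Measurable fun q : ℝ × ℝ => ENNReal.ofReal (p q.2) * G q.1 q.2 :=
    (hp.comp measurable_snd).ennreal_ofReal.mul hG
  rw [h.lintegral_comp (G := fun x => ∫⁻ y, ENNReal.ofReal (p y) * G x y)
    hm.lintegral_prod_right']
  refine lintegral_congr fun x => ?_
  exact (lintegral_const_mul _ (hm.comp measurable_prodMk_left)).symm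

theorem integral_comp (h : IsReparam p ψ) {G : ℝ → ℝ} (hG : Measurable G) :
    ∫ t, G (ψ t) = ∫ x, p x * G x := by
  rw [← integral_map h.measurable.aemeasurable hG.aestronglyMeasurable, h.map_eq,
    integral_withDensity_eq_integral_toReal_smul h.measurable_density.ennreal_ofReal
      (by simp)]
  simp only [ENNReal.toReal_ofReal (h.density_pos _).le, smul_eq_mul]

theorem integrable_comp (h : IsReparam p ψ) {G : ℝ → ℝ} (hG : Measurable G) :
    Integrable (fun t => G (ψ t)) ↔ Integrable fun x => p x * G x := by
  have := integrable_map_measure (μ := volume) (f := ψ) hG.aestronglyMeasurable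
    h.measurable.aemeasurable
  rw [← Function.comp_def, ← this, h.map_eq,
    integrable_withDensity_iff_integrable_smul' h.measurable_density.ennreal_ofReal (by simp)]
  simp only [ENNReal.toReal_ofReal (h.density_pos _).le, smul_eq_mul]

theorem abs_sub_le (h : IsReparam p ψ) (hp : ∀ x, p x ≤ 1) (t s : ℝ) :
    |t - s| ≤ |ψ t - ψ s| := by
  rw [h.abs_sub t s]
  have := intervalIntegral.norm_integral_le_of_norm_le_const (f := p) (a := ψ s) (b := ψ t)
    (C := 1) fun x _ => by rw [Real.norm_eq_abs, abs_of_pos (h.density_pos x)]; exact hp x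
  simpa using this

theorem abs_sub_ge (h : IsReparam p ψ) (hp : ∀ x, 1 ≤ p x) (t s : ℝ) :
    |ψ t - ψ s| ≤ |t - s| := by
  have key : ∀ a b : ℝ, a ≤ b → b - a ≤ ∫ x in a..b, p x := fun a b hab => by
    have := intervalIntegral.integral_mono_on hab (intervalIntegrable_const (c := (1 : ℝ)))
      (h.locallyIntegrable.integrableOn_isCompact isCompact_uIcc).intervalIntegrable fun s _ => hp s
    simpa using this
  rw [h.abs_sub t s]
  rcases le_total (ψ s) (ψ t) with hst | hst
  · rw [abs_of_nonneg (sub_nonneg.2 hst)]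
    exact (key _ _ hst).trans (le_abs_self _)
  · rw [abs_sub_comm, abs_of_nonneg (sub_nonneg.2 hst), intervalIntegral.integral_symm, abs_neg]
    exact (key _ _ hst).trans (le_abs_self _)

/-- `|t|` is the `p`-mass between `0` and `ψ t`. This bounds the support of a reparametrised
function. -/
theorem abs_le_of_mem (h : IsReparam p ψ) {t R : ℝ} (ht : |ψ t| ≤ R) :
    |t| ≤ ∫ x in Icc (-R) R, p x := by
  have := h.abs_sub t 0
  rw [sub_zero, h.map_zero] at this
  rw [this]
  have hi : IntegrableOn p (Icc (-R) R) := h.locallyIntegrable.integrableOn_isCompact isCompact_Icc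
  have hnn : 0 ≤ᵐ[volume.restrict (Icc (-R) R)] p :=
    Eventually.of_forall fun x => (h.density_pos x).le
  rw [abs_le] at ht
  refine (intervalIntegral.abs_integral_eq_abs_integral_uIoc p).trans_le ?_
  rw [abs_of_nonneg (integral_nonneg fun x => (h.density_pos x).le)]
  refine setIntegral_mono_set hi hnn (LE.le.eventuallyLE ?_)
  intro x hx
  rw [mem_uIoc] at hx
  rcases hx with hx | hx <;> constructor <;> linarith

end IsReparam

section Steps

variable {k p ψ f : ℝ → ℝ}

/-- Shrinking the set where a nonnegative function vanishes increases its energy. -/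
theorem IsReparam.kernelEnergy_le_of_shrink (h : IsReparam p ψ) (hk : IsBumpKernel k)
    (hp : ∀ x, p x ≤ 1) (hfp : ∀ x, f x ≠ 0 → p x = 1) (hm : Measurable f) (hf : MemLp f 2)
    (h0 : ∀ x, 0 ≤ f x) (hf' : MemLp (fun t => f (ψ t)) 2) :
    kernelEnergy k f ≤ kernelEnergy k fun t => f (ψ t) := by
  have hm' : Measurable fun t => f (ψ t) := hm.comp h.measurable
  rw [← ENNReal.ofReal_le_ofReal_iff (hk.energy_nonneg fun x => h0 _),
    ← hk.lintegral_energy hm hf h0,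
    ← hk.lintegral_energy hm' hf' fun x => h0 _]
  have hG : Measurable (Function.uncurry fun x y : ℝ =>
      ENNReal.ofReal (k (x - y) * (f x * f y))) :=
    (hk.measurable_sub.mul ((hm.comp measurable_fst).mul
      (hm.comp measurable_snd))).ennreal_ofReal
  calc ∫⁻ x, ∫⁻ y, ENNReal.ofReal (k (x - y) * (f x * f y))
      = ∫⁻ x, ∫⁻ y, ENNReal.ofReal (p x) * (ENNReal.ofReal (p y) *
          ENNReal.ofReal (k (x - y) * (f x * f y))) := by
        refine lintegral_congr fun x => lintegral_congr fun y => ?_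
        by_cases hx : f x = 0
        · simp [hx]
        by_cases hy : f y = 0
        · simp [hy]
        rw [hfp x hx, hfp y hy]
        simp
    _ = ∫⁻ t, ∫⁻ s, ENNReal.ofReal (k (ψ t - ψ s) * (f (ψ t) * f (ψ s))) :=
        (h.lintegral_lintegral_comp hG).symm
    _ ≤ _ := by
        refine lintegral_mono fun t => lintegral_mono fun s => ENNReal.ofReal_le_ofReal ?_
        exact mul_le_mul_of_nonneg_right (hk.anti _ _ (h.abs_sub_le hp t s))
          (mul_nonneg (h0 _) (h0 _))

/-- Cutting a nonnegative function at the height `B` and stretching the line by the factor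
`1 + 2 (f - B)₊ / B` decreases the Dirichlet form. -/
theorem IsReparam.dirichlet_le_of_stretch {B : ℝ} (hB : 0 < B)
    (h : IsReparam (fun x => 1 + 2 / B * max (f x - B) 0) ψ) (hk : IsBumpKernel k)
    (hm : Measurable f) (hf : MemLp f 2)
    (h0 : ∀ x, 0 ≤ f x) (hf' : MemLp (fun t => min (f (ψ t)) B) 2) :
    kernelEnergy k f - kernelEnergy k (fun t => min (f (ψ t)) B)
      ≤ (∫ x, f x ^ 2) - ∫ t, min (f (ψ t)) B ^ 2 := by
  have hgm : Measurable fun x => min (f x) B := hm.min measurable_const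
  have key : ∫⁻ t, ∫⁻ s, ENNReal.ofReal (k (t - s) * (min (f (ψ t)) B - min (f (ψ s)) B) ^ 2)
      ≤ ∫⁻ x, ∫⁻ y, ENNReal.ofReal (k (x - y) * (f x - f y) ^ 2) := by
    have hG : Measurable (Function.uncurry fun x y : ℝ =>
        ENNReal.ofReal (k (x - y) * (min (f x) B - min (f y) B) ^ 2)) :=
      (hk.measurable_sub.mul (((hgm.comp measurable_fst).sub
        (hgm.comp measurable_snd)).pow_const 2)).ennreal_ofReal
    have hp1 : ∀ x, 1 ≤ 1 + 2 / B * max (f x - B) 0 := fun x => by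
      have : 0 ≤ 2 / B * max (f x - B) 0 := by positivity
      linarith
    calc _ ≤ ∫⁻ t, ∫⁻ s, ENNReal.ofReal
          (k (ψ t - ψ s) * (min (f (ψ t)) B - min (f (ψ s)) B) ^ 2) := by
          refine lintegral_mono fun t => lintegral_mono fun s => ENNReal.ofReal_le_ofReal ?_
          exact mul_le_mul_of_nonneg_right (hk.anti _ _ (h.abs_sub_ge hp1 t s)) (sq_nonneg _)
      _ = _ := h.lintegral_lintegral_comp hG
      _ ≤ _ := by
          refine lintegral_mono fun x => lintegral_mono fun y => ?_
          have hx1 := hp1 x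
          have hy1 := hp1 y
          rw [← ENNReal.ofReal_mul (by linarith), ← ENNReal.ofReal_mul (by linarith)]
          refine ENNReal.ofReal_le_ofReal ?_
          rw [mul_left_comm _ (k (x - y)), mul_left_comm _ (k (x - y))]
          refine mul_le_mul_of_nonneg_left ?_ (hk.nonneg _)
          -- Expand `(u - v)²` around `B`: the cross term `2(u - B)(B - v)` pays for the stretching
          -- because `(B - v)/B ≤ 1`, which uses `v ≥ 0`. If both values exceed `B` the truncated
          -- difference vanishes, so at most one stretching factor ever matters.
          have hc : ∀ u v : ℝ, B ≤ u → 0 ≤ v → v ≤ B →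
              (1 + 2 / B * (u - B)) * (B - v) ^ 2 ≤ (u - v) ^ 2 := by
            intro u v hu hv hvB
            have e : 2 / B * (u - B) * (B - v) ^ 2 = 2 * (u - B) * ((B - v) * ((B - v) / B)) := by
              field_simp
            have h1 : (B - v) / B ≤ 1 := by rw [div_le_one hB]; linarith
            have h2 : (B - v) * ((B - v) / B) ≤ B - v :=
              mul_le_of_le_one_right (by linarith) h1
            have h3 : 2 * (u - B) * ((B - v) * ((B - v) / B)) ≤ 2 * (u - B) * (B - v) :=
              mul_le_mul_of_nonneg_left h2 (by linarith)
            nlinarith [sq_nonneg (u - B)]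
          rcases le_total (f x) B with hx | hx <;> rcases le_total (f y) B with hy | hy
          · simp [hx, hy]
          · rw [max_eq_right (by linarith), max_eq_left (by linarith), min_eq_left hx,
              min_eq_right hy]
            have := hc (f y) (f x) hy (h0 x) hx
            nlinarith
          · rw [max_eq_left (by linarith), max_eq_right (by linarith), min_eq_right hx,
              min_eq_left hy]
            have := hc (f x) (f y) hx (h0 y) hy
            nlinarith
          · simp only [min_eq_right hx, min_eq_right hy, sub_self]
            simp only [ne_eq, OfNat.ofNat_ne_zero, not_false_eq_true, zero_pow, mul_zero]
            positivity
  have hgm' : Measurable fun t => min (f (ψ t)) B := hgm.comp h.measurable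
  rw [hk.lintegral_dirichlet hgm' hf', hk.lintegral_dirichlet hm hf,
    ENNReal.ofReal_le_ofReal_iff (hk.dirichlet_nonneg hm hf)] at key
  linarith

end Steps

/-! ### The truncated competitor. -/

theorem integrable_of_memLp_two_of_support {f : ℝ → ℝ} {R : ℝ} (hf : MemLp f 2)
    (hs : ∀ x, f x ≠ 0 → |x| ≤ R) : Integrable f := by
  have h1 : IntegrableOn f (Icc (-R) R) :=
    (hf.restrict (Icc (-R) R)).integrable (by norm_num)
  refine (integrableOn_iff_integrable_of_support_subset fun x hx => ?_).1 h1
  exact abs_le.1 (hs x hx)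

/-- Cutting `f` from below at the height `δ` and from above at the height `B`, closing the gaps
and stretching gives a function with controlled support and no larger Dirichlet form. -/
theorem exists_truncation {f : ℝ → ℝ} (hm : Measurable f) (hf : MemLp f 2) {R δ B : ℝ}
    (hR : 0 ≤ R) (hs : ∀ x, f x ≠ 0 → |x| ≤ R) (hδ : 0 < δ) (hB : 0 < B) :
    ∃ g : ℝ → ℝ, Measurable g ∧ MemLp g 2 ∧
      (∀ t, g t ≠ 0 → |t| ≤ 2 * ((∫ x, f x ^ 2) / δ ^ 2 + 1) + 2 / B ^ 2 * ∫ x, f x ^ 2) ∧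
      (∀ m : ℝ → ℝ, GaussMix m → symbolEnergy m f - symbolEnergy m g
        ≤ ((∫ x, f x ^ 2) - ∫ t, g t ^ 2) * m 0) ∧
      ∀ G : ℝ → ℝ, Measurable G → G 0 = 0 →
        ((Integrable fun t => G (g t)) ↔ Integrable fun x =>
          (1 + 2 / B * max (max (|f x| - δ) 0 - B) 0) * G (min (max (|f x| - δ) 0) B)) ∧
        ∫ t, G (g t) = ∫ x,
          (1 + 2 / B * max (max (|f x| - δ) 0 - B) 0) * G (min (max (|f x| - δ) 0) B) := by
  classical
  set f₁ : ℝ → ℝ := fun x => max (|f x| - δ) 0 with hf₁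
  have hm₁ : Measurable f₁ := ((measurable_norm.comp hm).sub_const δ).max measurable_const
  have hf₁0 : ∀ x, 0 ≤ f₁ x := fun x => le_max_right _ _
  have hf₁le : ∀ x, f₁ x ≤ |f x| := fun x => max_le (by linarith) (abs_nonneg _)
  have hL₁ : MemLp f₁ 2 := hf.of_le hm₁.aestronglyMeasurable (Eventually.of_forall fun x => by
    rw [Real.norm_eq_abs, Real.norm_eq_abs, abs_of_nonneg (hf₁0 x)]; exact hf₁le x)
  have hsupp₁ : ∀ x, f₁ x ≠ 0 → δ ≤ |f x| := fun x hx => by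
    by_contra! h
    exact hx (max_eq_right (by linarith))
  -- The gaps inside `[-R, R]` shrink to total length at most `2R/(2R+1) ≤ 1`, and the rest has
  -- length at most `S/δ²` by Chebyshev. The density is kept positive so that the change of variable
  -- is a bijection.
  set p : ℝ → ℝ := fun x => if f₁ x = 0 then (2 * R + 1)⁻¹ else 1 with hp
  have he0 : 0 < (2 * R + 1)⁻¹ := by positivity
  have he1 : (2 * R + 1)⁻¹ ≤ 1 := inv_le_one_of_one_le₀ (by linarith)
  have hpm : Measurable p := Measurable.ite (hm₁ (measurableSet_singleton 0))
    measurable_const measurable_const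
  have hple : ∀ x, p x ≤ 1 := fun x => by simp only [hp]; split_ifs <;> simp [he1]
  have hpge : ∀ x, (2 * R + 1)⁻¹ ≤ p x := fun x => by simp only [hp]; split_ifs <;> simp [he1]
  have hploc : LocallyIntegrable p :=
    (locallyIntegrable_const (1 : ℝ)).mono hpm.aestronglyMeasurable
      (Eventually.of_forall fun x => by
        rw [Real.norm_eq_abs, abs_of_pos (he0.trans_le (hpge x))]; simpa using hple x)
  obtain ⟨ψ, hψ⟩ := exists_isReparam hpm he0 hpge hploc
  have hpf : ∀ x, f₁ x ≠ 0 → p x = 1 := fun x hx => by simp [hp, hx]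
  have hpG : ∀ (H : ℝ → ℝ), H 0 = 0 → ∀ x, p x * H (f₁ x) = H (f₁ x) := fun H hH x => by
    by_cases hx : f₁ x = 0
    · rw [hx, hH, mul_zero]
    · rw [hpf x hx, one_mul]
  set f₂ : ℝ → ℝ := fun t => f₁ (ψ t) with hf₂
  have hm₂ : Measurable f₂ := hm₁.comp hψ.measurable
  have hint₂ : ∀ H : ℝ → ℝ, Measurable H → H 0 = 0 →
      ((Integrable fun t => H (f₂ t)) ↔ Integrable fun x => H (f₁ x)) := fun H hH hH0 => by
    have := hψ.integrable_comp (G := fun x => H (f₁ x)) (hH.comp hm₁)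
    simpa only [hpG H hH0] using this
  have hval₂ : ∀ H : ℝ → ℝ, Measurable H → H 0 = 0 →
      ∫ t, H (f₂ t) = ∫ x, H (f₁ x) := fun H hH hH0 => by
    have := hψ.integral_comp (G := fun x => H (f₁ x)) (hH.comp hm₁)
    simpa only [hpG H hH0] using this
  have hsq : Measurable fun y : ℝ => y ^ 2 := by fun_prop
  have hL₂ : MemLp f₂ 2 := by
    rw [memLp_two_iff_integrable_sq hm₂.aestronglyMeasurable]
    exact (hint₂ _ hsq (by simp)).2 hL₁.integrable_sq
  have hsq₂ : ∫ t, f₂ t ^ 2 = ∫ x, f₁ x ^ 2 := hval₂ _ hsq (by simp)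
  have hsq₁ : ∫ x, f₁ x ^ 2 ≤ ∫ x, f x ^ 2 :=
    integral_mono hL₁.integrable_sq hf.integrable_sq fun x => by
      have := hf₁le x
      have := hf₁0 x
      simp only
      rw [← sq_abs (f x)]
      gcongr
  set S : ℝ := ∫ x, f x ^ 2 with hS
  have hS0 : 0 ≤ S := integral_nonneg fun x => sq_nonneg _
  set L : ℝ := S / δ ^ 2 + 1 with hL
  have hL0 : 0 ≤ L := by positivity
  have hsupp₂ : ∀ t, f₂ t ≠ 0 → |t| ≤ L := by
    intro t ht
    have hfx : f (ψ t) ≠ 0 := fun h0 => by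
      have := hsupp₁ _ ht
      rw [h0, abs_zero] at this
      linarith
    refine (hψ.abs_le_of_mem (hs _ hfx)).trans ?_
    have hi : Integrable (fun x => (1 / δ ^ 2) * f x ^ 2) := hf.integrable_sq.const_mul _
    have hc : IntegrableOn (fun _ : ℝ => (2 * R + 1)⁻¹) (Icc (-R) R) :=
      integrableOn_const (by simp)
    calc ∫ x in Icc (-R) R, p x
        ≤ ∫ x in Icc (-R) R, ((1 / δ ^ 2) * f x ^ 2 + (2 * R + 1)⁻¹) := by
          refine setIntegral_mono (hploc.integrableOn_isCompact isCompact_Icc)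
            (hi.integrableOn.add hc) fun x => ?_
          simp only [hp]
          split_ifs with h
          · have : 0 ≤ 1 / δ ^ 2 * f x ^ 2 := by positivity
            linarith
          · have h1 := hsupp₁ x h
            have : 1 ≤ 1 / δ ^ 2 * f x ^ 2 := by
              rw [one_div_mul_eq_div, one_le_div (by positivity), ← sq_abs (f x)]
              gcongr
            linarith
      _ = (∫ x in Icc (-R) R, (1 / δ ^ 2) * f x ^ 2) + 2 * R * (2 * R + 1)⁻¹ := by
          rw [integral_add hi.integrableOn hc]
          simp only [integral_const, smul_eq_mul]
          congr 2
          simp [Measure.real, Real.volume_Icc]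
          rw [ENNReal.toReal_ofReal (by linarith)]
          ring
      _ ≤ (∫ x, (1 / δ ^ 2) * f x ^ 2) + 1 := by
          refine add_le_add (setIntegral_le_integral hi
            (Eventually.of_forall fun x => by positivity)) ?_
          rw [← div_eq_mul_inv, div_le_one (by linarith)]
          linarith
      _ = L := by
          rw [integral_const_mul, hL]
          ring
  have hI₂ : Integrable f₂ := integrable_of_memLp_two_of_support hL₂ hsupp₂
  have hf₂0 : ∀ t, 0 ≤ f₂ t := fun t => hf₁0 _
  set q : ℝ → ℝ := fun x => 1 + 2 / B * max (f₂ x - B) 0 with hq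
  have hqi : Integrable fun x => 2 / B * max (f₂ x - B) 0 := by
    refine (hI₂.mono ((hm₂.sub_const B).max measurable_const).aestronglyMeasurable
      (Eventually.of_forall fun x => ?_)).const_mul _
    rw [Real.norm_eq_abs, Real.norm_eq_abs, abs_of_nonneg (le_max_right _ _),
      abs_of_nonneg (hf₂0 x)]
    exact max_le (by linarith) (hf₂0 x)
  have hqloc : LocallyIntegrable q :=
    (locallyIntegrable_const (1 : ℝ)).add hqi.locallyIntegrable
  have hqm : Measurable q := measurable_const.add
    (((hm₂.sub_const B).max measurable_const).const_mul _)
  have hq1 : ∀ x, 1 ≤ q x := fun x => by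
    have : 0 ≤ 2 / B * max (f₂ x - B) 0 := by positivity
    simp only [hq]
    linarith
  obtain ⟨χ, hχ⟩ := exists_isReparam hqm one_pos hq1 hqloc
  have hmg : Measurable fun t => min (f₂ (χ t)) B := (hm₂.comp hχ.measurable).min measurable_const
  have hG : ∀ G : ℝ → ℝ, Measurable G → G 0 = 0 →
      ((Integrable fun t => G (min (f₂ (χ t)) B)) ↔ Integrable fun x =>
        (1 + 2 / B * max (f₁ x - B) 0) * G (min (f₁ x) B)) ∧
      ∫ t, G (min (f₂ (χ t)) B) = ∫ x,
        (1 + 2 / B * max (f₁ x - B) 0) * G (min (f₁ x) B) := by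
    intro G hG hG0
    have hGm : Measurable fun x => G (min (f₂ x) B) := hG.comp (hm₂.min measurable_const)
    have hH : Measurable fun y : ℝ => (1 + 2 / B * max (y - B) 0) * G (min y B) :=
      (by fun_prop : Measurable fun y : ℝ => 1 + 2 / B * max (y - B) 0).mul
        (hG.comp (measurable_id.min measurable_const))
    have hH0 : (1 + 2 / B * max ((0 : ℝ) - B) 0) * G (min 0 B) = 0 := by
      rw [min_eq_left hB.le, hG0, mul_zero]
    exact ⟨(hχ.integrable_comp hGm).trans (hint₂ _ hH hH0),
      (hχ.integral_comp hGm).trans (hval₂ _ hH hH0)⟩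
  have hLg : MemLp (fun t => min (f₂ (χ t)) B) 2 := by
    rw [memLp_two_iff_integrable_sq hmg.aestronglyMeasurable, (hG _ hsq (by simp)).1]
    refine hL₁.integrable_sq.mono
      (((((hm₁.sub_const B).max measurable_const).const_mul _).const_add 1).mul
        ((hm₁.min measurable_const).pow_const 2)).aestronglyMeasurable
      (Eventually.of_forall fun x => ?_)
    rw [Real.norm_eq_abs, Real.norm_eq_abs, abs_of_nonneg (by positivity),
      abs_of_nonneg (by positivity)]
    rcases le_total (f₁ x) B with h | h
    · rw [max_eq_right (by linarith), min_eq_left h]; simp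
    · rw [max_eq_left (by linarith), min_eq_right h]
      have : (1 + 2 / B * (f₁ x - B)) * B ^ 2 = B ^ 2 + 2 * (f₁ x - B) * B := by field_simp
      rw [this]
      nlinarith [sq_nonneg (f₁ x - B)]
  have hsuppg : ∀ t, min (f₂ (χ t)) B ≠ 0 → |t| ≤ 2 * L + 2 / B ^ 2 * S := by
    intro t ht
    have hfx : f₂ (χ t) ≠ 0 := fun h0 => ht (by rw [h0, min_eq_left hB.le])
    refine (hχ.abs_le_of_mem (hsupp₂ _ hfx)).trans ?_
    have hi : Integrable (fun x => (2 / B ^ 2) * f₂ x ^ 2) := hL₂.integrable_sq.const_mul _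
    have hc : IntegrableOn (fun _ : ℝ => (1 : ℝ)) (Icc (-L) L) := integrableOn_const (by simp)
    calc ∫ x in Icc (-L) L, q x ≤ ∫ x in Icc (-L) L, (1 + (2 / B ^ 2) * f₂ x ^ 2) := by
          refine setIntegral_mono (hqloc.integrableOn_isCompact isCompact_Icc)
            (hc.add hi.integrableOn) fun x => ?_
          have h1 : max (f₂ x - B) 0 ≤ f₂ x ^ 2 / B := by
            refine max_le ?_ (by positivity)
            rw [le_div_iff₀ hB]
            nlinarith [sq_nonneg (f₂ x - B), hf₂0 x]
          have h2 : 2 / B * max (f₂ x - B) 0 ≤ 2 / B * (f₂ x ^ 2 / B) := by gcongr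
          have h3 : 2 / B * (f₂ x ^ 2 / B) = 2 / B ^ 2 * f₂ x ^ 2 := by field_simp
          simp only [hq]
          linarith
      _ = 2 * L + ∫ x in Icc (-L) L, (2 / B ^ 2) * f₂ x ^ 2 := by
          rw [integral_add hc hi.integrableOn]
          congr 1
          simp [Measure.real, Real.volume_Icc]
          rw [ENNReal.toReal_ofReal (by linarith)]
          ring
      _ ≤ 2 * L + ∫ x, (2 / B ^ 2) * f₂ x ^ 2 := by
          exact add_le_add le_rfl
            (setIntegral_le_integral hi (Eventually.of_forall fun x => by positivity))
      _ ≤ _ := by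
          rw [integral_const_mul, hsq₂]
          gcongr
  refine ⟨fun t => min (f₂ (χ t)) B, hmg, hLg, hsuppg, fun m hM => ?_, hG⟩
  refine hM.energy_sub_le (integrable_of_memLp_two_of_support hf hs) hf
    (integrable_of_memLp_two_of_support hLg hsuppg) hLg fun t ht => ?_
  have hk := isBumpKernel_gaussKernel ht
  rw [symbolEnergy_gauss ht hm (integrable_of_memLp_two_of_support hf hs) hf,
    symbolEnergy_gauss ht hmg (integrable_of_memLp_two_of_support hLg hsuppg) hLg]
  have h1 := hk.energy_sub_le_of_contraction hm hf hm₁ hL₁ fun x y => by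
    simp only [hf₁]
    refine (abs_max_sub_max_le_abs _ _ _).trans ?_
    rw [sub_sub_sub_cancel_right]
    exact abs_abs_sub_abs_le_abs_sub _ _
  have h2 := hψ.kernelEnergy_le_of_shrink hk hple hpf hm₁ hL₁ hf₁0 hL₂
  have h3 := hχ.dirichlet_le_of_stretch hB hk hm₂ hL₂ hf₂0 hLg
  have h2' : kernelEnergy (gaussKernel t) f₁ ≤ kernelEnergy (gaussKernel t) f₂ := h2
  linarith

/-! ### The modular, the gauge norm and the lower bound on the maximal energy. -/

theorem youngPsi_le_of_le {a x y : ℝ} (ha : 0 < a) (hx : 0 ≤ x) (hxy : x ≤ y) :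
    youngPsi a x ≤ youngPsi a y := by
  rcases hx.eq_or_lt with rfl | hx
  · rw [youngPsi_zero ha]; exact youngPsi_nonneg ha y
  · have h1 : 1 ≤ y / x := by rwa [one_le_div hx]
    have h2 := mul_youngPsi_le ha h1 x
    rw [div_mul_cancel₀ _ hx.ne'] at h2
    exact (le_mul_of_one_le_left (youngPsi_nonneg ha x) h1).trans h2

theorem measurable_youngPsi (a : ℝ) : Measurable (youngPsi a) := (continuous_youngPsi a).measurable

theorem heightB_pos {a : ℝ} (ha : 0 < a) : 0 < heightB a := by
  have := (heightB_bounds ha).1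
  nlinarith

/-- The definition of the infimum controls `f / r` for every `r > 1`; Fatou's lemma lets `r`
decrease to `1`. -/
theorem modular_le_one {a : ℝ} {f : ℝ → ℝ} (ha : 0 < a) (hm : AEStronglyMeasurable f)
    (hf : gaugeNorm a f = 1) : modular a f ≤ 1 := by
  have hr : ∀ r : ℝ, 1 < r → modular a (fun x => f x / r) ≤ 1 := by
    intro r hr
    -- An empty set would have infimum `0` by convention, not `1`.
    have hne : {r : ℝ | 0 < r ∧ modular a (fun x => f x / r) ≤ 1}.Nonempty := by
      by_contra h
      rw [not_nonempty_iff_eq_empty] at h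
      rw [gaugeNorm, h, Real.sInf_empty] at hf
      exact zero_ne_one hf
    rw [gaugeNorm] at hf
    obtain ⟨s, ⟨hs0, hs1⟩, hsr⟩ := exists_lt_of_csInf_lt hne (hf.trans_lt hr)
    refine (lintegral_mono fun x => ENNReal.ofReal_le_ofReal ?_).trans hs1
    rw [← youngPsi_abs a (f x / r), ← youngPsi_abs a (f x / s), abs_div, abs_div,
      abs_of_pos hs0, abs_of_pos (by linarith : 0 < r)]
    exact youngPsi_le_of_le ha (by positivity) (by gcongr)
  have hlim : ∀ x, Tendsto (fun k : ℕ => ENNReal.ofReal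
      (youngPsi a (f x / (1 + 1 / ((k : ℝ) + 1))))) atTop
      (nhds (ENNReal.ofReal (youngPsi a (f x)))) := by
    intro x
    refine ENNReal.tendsto_ofReal (((continuous_youngPsi a).tendsto _).comp ?_)
    have := (tendsto_one_div_add_atTop_nhds_zero_nat (𝕜 := ℝ)).const_add 1
    have := (tendsto_const_nhds (x := f x)).div this (by norm_num)
    simpa [Pi.div_def] using this
  have hmeas : ∀ k : ℕ, AEMeasurable (fun x => ENNReal.ofReal
      (youngPsi a (f x / (1 + 1 / ((k : ℝ) + 1))))) := fun k =>
    ((measurable_youngPsi a).comp_aemeasurable (hm.aemeasurable.div_const _)).ennreal_ofReal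
  calc modular a f = ∫⁻ x, liminf (fun k : ℕ => ENNReal.ofReal
        (youngPsi a (f x / (1 + 1 / ((k : ℝ) + 1))))) atTop :=
        lintegral_congr fun x => ((hlim x).liminf_eq).symm
    _ ≤ liminf (fun k : ℕ => modular a (fun x => f x / (1 + 1 / ((k : ℝ) + 1)))) atTop :=
        lintegral_liminf_le' hmeas
    _ ≤ liminf (fun _ : ℕ => (1 : ℝ≥0∞)) atTop :=
        liminf_le_liminf (Eventually.of_forall fun k => hr _ (by
          have : 0 < 1 / ((k : ℝ) + 1) := by positivity
          linarith))
    _ = 1 := by simp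

theorem gaugeNorm_eq_one {a : ℝ} {f : ℝ → ℝ} (ha : 0 < a) (hf : modular a f = 1) :
    gaugeNorm a f = 1 := by
  have h1 : (1 : ℝ) ∈ {r : ℝ | 0 < r ∧ modular a (fun x => f x / r) ≤ 1} := by
    simp [hf]
  refine le_antisymm (csInf_le ⟨0, fun r hr => hr.1.le⟩ h1) (le_csInf ⟨1, h1⟩ ?_)
  rintro r ⟨hr0, hr⟩
  by_contra! hr1
  have h2 : ENNReal.ofReal r⁻¹ * modular a f ≤ modular a (fun x => f x / r) := by
    rw [modular, ← lintegral_const_mul' _ _ ENNReal.ofReal_ne_top]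
    refine lintegral_mono fun x => ?_
    rw [← ENNReal.ofReal_mul (inv_pos.2 hr0).le]
    refine ENNReal.ofReal_le_ofReal ?_
    have := mul_youngPsi_le ha ((one_lt_inv₀ hr0).2 hr1).le (f x)
    rwa [inv_mul_eq_div r (f x)] at this
  rw [hf, mul_one] at h2
  have h3 : (1 : ℝ≥0∞) < ENNReal.ofReal r⁻¹ := by
    rw [ENNReal.one_lt_ofReal]; exact (one_lt_inv₀ hr0).2 hr1
  exact absurd (h2.trans hr) (not_le.2 h3)

theorem mem_localConstraint {a : ℝ} {l : ℕ} {f : ℝ → ℝ} (ha : 0 < a) (hm : Measurable f)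
    (hi : Integrable fun x => youngPsi a (f x)) (h1 : ∫ x, youngPsi a (f x) = 1)
    (hs : ∀ x, f x ≠ 0 → |x| ≤ 2 ^ l) : f ∈ localConstraint a l := by
  have hmod : modular a f = 1 := by
    rw [modular, ← ofReal_integral_eq_lintegral_ofReal hi
      (Eventually.of_forall fun x => youngPsi_nonneg ha _), h1, ENNReal.ofReal_one]
  refine ⟨⟨hm.aestronglyMeasurable, 1, one_pos, ?_⟩, gaugeNorm_eq_one ha hmod,
    Eventually.of_forall fun x hx => ?_⟩
  · simp [hmod]
  · by_contra h
    exact hx (abs_le.1 (hs x h))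

theorem whithamSymbol_sq_zero : whithamSymbol (1 / 4) 0 ^ 2 = 1 := by simp [whithamSymbol]

theorem continuousAt_whithamSymbol_sq :
    ContinuousAt (fun x => whithamSymbol (1 / 4) x ^ 2) 0 := by
  refine ContinuousAt.pow ?_ 2
  have ht : Tendsto (fun x : ℝ => Real.tanh x / x) (nhdsWithin 0 {0}ᶜ) (nhds 1) := by
    have hd : HasDerivAt (fun x => Real.sinh x / Real.cosh x) 1 0 := by
      have := (Real.hasDerivAt_sinh 0).div (Real.hasDerivAt_cosh 0) (Real.cosh_pos 0).ne'
      exact this.congr_deriv (by simp)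
    rw [hasDerivAt_iff_tendsto_slope_zero] at hd
    refine hd.congr fun x => ?_
    simp [Real.tanh_eq_sinh_div_cosh, div_eq_inv_mul]
  rw [continuousAt_iff_punctured_nhds]
  have h0 : whithamSymbol (1 / 4) 0 = 1 := by simp [whithamSymbol]
  rw [h0]
  have h2 := ht.rpow_const (p := (1 / 4 : ℝ)) (Or.inl one_ne_zero)
  rw [Real.one_rpow] at h2
  refine h2.congr' ?_
  filter_upwards [self_mem_nhdsWithin] with x hx
  rw [whithamSymbol, if_neg (show x ≠ 0 from hx)]

theorem symbolEnergy_const_mul (m f : ℝ → ℝ) (c : ℝ) :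
    symbolEnergy m (fun x => c * f x) = c ^ 2 * symbolEnergy m f := by
  unfold symbolEnergy
  rw [← integral_const_mul]
  congr 1
  ext w
  have : 𝓕 (fun x => ((c * f x : ℝ) : ℂ)) w = c * 𝓕 (fun x => (f x : ℂ)) w := by
    rw [Real.fourier_real_eq, Real.fourier_real_eq, ← integral_const_mul]
    congr 1
    ext x
    rw [Circle.smul_def, Circle.smul_def]
    push_cast
    simp only [smul_eq_mul]
    ring
  rw [this, norm_mul, mul_pow, Complex.norm_real, Real.norm_eq_abs, sq_abs]
  ring

/-- Low and wide functions show that the maximal energy is at least `1 / a` asymptotically. -/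
theorem eventually_exists_energy_ge {a σ : ℝ} (ha : 0 < a) (hσ : 0 < σ) :
    ∀ᶠ l : ℕ in atTop, ∃ f ∈ localConstraint a l, 1 - σ ≤ a * dispersiveEnergy f ^ 2 := by
  classical
  set χ : ℝ → ℝ := (Icc (-1 : ℝ) 1).indicator fun _ => 1 with hχ
  have hχm : Measurable χ := measurable_const.indicator measurableSet_Icc
  have hχL : MemLp χ 2 := memLp_indicator_const 2 measurableSet_Icc 1 (Or.inr (by simp))
  have hχ1 : Integrable χ := memLp_one_iff_integrable.1
    (memLp_indicator_const 1 measurableSet_Icc 1 (Or.inr (by simp)))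
  have hint : ∀ c : ℝ, ∫ x, (Icc (-1 : ℝ) 1).indicator (fun _ => c) x = 2 * c := fun c => by
    rw [integral_indicator measurableSet_Icc]
    simp [Measure.real]
    norm_num
  have hpow : Tendsto (fun l : ℕ => (2 : ℝ) ^ l) atTop atTop :=
    tendsto_pow_atTop_atTop_of_one_lt (by norm_num)
  have hlim := gaussMix_whithamSymbol_sq.tendsto_energy_comp_div
    continuousAt_whithamSymbol_sq hχ1 hχL hpow
  have hsq : ∫ x, χ x ^ 2 = 2 := by
    have e : (fun x => χ x ^ 2) = (Icc (-1 : ℝ) 1).indicator fun _ => 1 := by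
      ext x; by_cases hx : x ∈ Icc (-1 : ℝ) 1 <;> simp [hχ, hx]
    rw [e, hint]; norm_num
  rw [whithamSymbol_sq_zero, hsq, one_mul] at hlim
  filter_upwards [hlim.eventually (lt_mem_nhds (by linarith : 2 * (1 - σ) < 2)),
    hpow.eventually_ge_atTop (1 / (4 / 3 * a ^ 3))] with l hl hl2
  set R : ℝ := (2 : ℝ) ^ l with hR
  have hR0 : 0 < R := by positivity
  -- The height `A` gives a plateau on `[-R, R]` modular exactly one; `R` is large enough that
  -- `1/(2R) ≤ Ψ(a)`. Then `a A² ≥ Ψ(A) = 1/(2R)`, while the energy is `A² R` times a quantity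
  -- tending to `2`.
  obtain ⟨A, hA0, hAa, hA⟩ := exists_youngPsi_eq (q := 1 / (2 * R)) ha (by positivity) (by
    rw [div_le_iff₀ (by positivity)] at hl2 ⊢
    linarith)
  have hcomp : ∀ x, youngPsi a (A * χ (x / R))
      = (Icc (-1 : ℝ) 1).indicator (fun _ => 1 / (2 * R)) (x / R) := fun x => by
    by_cases hx : x / R ∈ Icc (-1 : ℝ) 1
    · simp [hχ, hx, hA]
    · simp [hχ, hx, youngPsi_zero ha]
  have hc1 : Integrable ((Icc (-1 : ℝ) 1).indicator fun _ => 1 / (2 * R)) :=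
    memLp_one_iff_integrable.1 (memLp_indicator_const 1 measurableSet_Icc _ (Or.inr (by simp)))
  have hχR : Measurable fun x => χ (x / R) := hχm.comp (measurable_id.div_const R)
  have hL : MemLp (fun x => χ (x / R)) 2 := by
    rw [memLp_two_iff_integrable_sq hχR.aestronglyMeasurable]
    exact hχL.integrable_sq.comp_div hR0.ne'
  refine ⟨fun x => A * χ (x / R), mem_localConstraint ha
    (hχR.const_mul A) ?_ ?_ fun x hx => ?_, ?_⟩
  · simp only [hcomp]
    exact hc1.comp_div hR0.ne'
  · simp only [hcomp]
    rw [Measure.integral_comp_div, hint, abs_of_pos hR0, smul_eq_mul]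
    field_simp
  · have : x / R ∈ Icc (-1 : ℝ) 1 := by
      by_contra h
      exact hx (by simp [hχ, h])
    have := abs_le.2 this
    rwa [abs_div, abs_of_pos hR0, div_le_one hR0] at this
  · rw [dispersiveEnergy_sq ((hχ1.comp_div hR0.ne').const_mul A) (hL.const_mul A),
      symbolEnergy_const_mul, symbolEnergy_comp_div hR0]
    have h1 := youngPsi_le_mul_sq hA0 hAa
    rw [hA] at h1
    rw [div_le_iff₀ (by positivity)] at h1
    rcases le_total 1 σ with hσ1 | hσ1
    · have : 0 ≤ symbolEnergy (fun x => whithamSymbol (1 / 4) (x / R) ^ 2) χ :=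
        integral_nonneg fun w => by positivity
      calc 1 - σ ≤ 0 := by linarith
        _ ≤ _ := by positivity
    · calc 1 - σ ≤ a * A ^ 2 * (2 * R) * (1 - σ) :=
            le_mul_of_one_le_left (by linarith) h1
        _ = a * (A ^ 2 * (R * (2 * (1 - σ)))) := by ring
        _ ≤ _ := by gcongr

/-! ### The gain from truncation and the contradiction. -/

/-- Pointwise balance of the whole truncation. The lowering by `δ` costs `(σ + 3δ/a) y²`, and the
cut at `B` gains `w²/5` with `w` the excess over `B`. The bound `w² ≥ 2θw - θ²` makes the gain
linear, so that it integrates against the `L¹` mass above `B`; the correction lives on `{|y| ≥ B}`,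
where `1 ≤ y²/B²`. -/
theorem truncation_gain {a c σ δ θ : ℝ} (ha : 0 < a) (hc0 : 0 ≤ c) (hc : 1 - σ ≤ a * c)
    (hc' : c ≤ 3 / a) (hσ : 0 ≤ σ) (hσ' : σ ≤ 1 / 10) (hδ : 0 ≤ δ) (hθ : 0 ≤ θ) (y : ℝ) :
    y ^ 2 - c * youngPsi a y - (σ + 3 * δ / a) * y ^ 2
      + 1 / 5 * (2 * θ * max (|y| - heightB a) 0
        - (2 * θ * δ + θ ^ 2) / heightB a ^ 2 * y ^ 2)
    ≤ (1 + 2 / heightB a * max (max (|y| - δ) 0 - heightB a) 0) *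
      (min (max (|y| - δ) 0) (heightB a) ^ 2
        - c * youngPsi a (min (max (|y| - δ) 0) (heightB a))) := by
  have hB := heightB_pos ha
  have hBa := (heightB_bounds ha).1
  have key := sub_mul_youngPsi_le ha hc0 hc hc' hσ hδ (abs_nonneg y)
  rw [youngPsi_abs, sq_abs] at key
  have hz0 : 0 ≤ max (|y| - δ) 0 := le_max_right _ _
  have hzy : |y| - δ ≤ max (|y| - δ) 0 := le_max_left _ _
  generalize max (|y| - δ) 0 = z at *
  have hstep : z ^ 2 - c * youngPsi a z + 1 / 5 * max (z - heightB a) 0 ^ 2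
      ≤ (1 + 2 / heightB a * max (z - heightB a) 0) *
      (min z (heightB a) ^ 2 - c * youngPsi a (min z (heightB a))) := by
    rcases le_total z (heightB a) with h | h
    · rw [max_eq_right (by linarith), min_eq_left h]
      linarith
    · rw [max_eq_left (by linarith), min_eq_right h]
      have e := youngPsi_heightB_mul ha (sub_nonneg.2 h)
      rw [add_sub_cancel] at e
      have e2 : (1 + 2 / heightB a * (z - heightB a)) * heightB a ^ 2
          = z ^ 2 - (z - heightB a) ^ 2 := by field_simp; ring
      -- From `a c ≥ 9/10` and `B - a ≥ 0.475 a`. The excess over `1`, the coefficient of the loss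
      -- in `z²`, is the `1/5` of the statement.
      have e3 : 6 / 5 ≤ c * (3 * (heightB a - a)) := by nlinarith
      have hh := sub_nonneg.2 h
      generalize z - heightB a = w at *
      have e4 : 6 / 5 * w ^ 2 ≤ c * (3 * (heightB a - a)) * w ^ 2 := by gcongr
      have e5 : 0 ≤ c * w ^ 3 := by positivity
      linear_combination e4 + e5 - e2 + c * e
  have hsq : 2 * θ * max (|y| - heightB a) 0
      - (2 * θ * δ + θ ^ 2) / heightB a ^ 2 * y ^ 2 ≤ max (z - heightB a) 0 ^ 2 := by
    rcases le_total |y| (heightB a) with h | h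
    · rw [max_eq_right (by linarith)]
      have : 0 ≤ (2 * θ * δ + θ ^ 2) / heightB a ^ 2 * y ^ 2 := by positivity
      nlinarith [sq_nonneg (max (z - heightB a) 0)]
    · rw [max_eq_left (by linarith)]
      have h1 : 1 ≤ y ^ 2 / heightB a ^ 2 := by
        rw [one_le_div (by positivity), ← sq_abs y]; gcongr
      have h2 : 2 * θ * δ + θ ^ 2 ≤ (2 * θ * δ + θ ^ 2) / heightB a ^ 2 * y ^ 2 := by
        rw [div_mul_eq_mul_div, mul_div_assoc]
        exact le_mul_of_one_le_right (by positivity) h1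
      have h3 : |y| - heightB a - δ ≤ max (z - heightB a) 0 :=
        le_trans (by linarith) (le_max_left _ _)
      generalize max (z - heightB a) 0 = w at *
      nlinarith [sq_nonneg (w - θ), mul_le_mul_of_nonneg_left h3 hθ]
  linarith

theorem dispersiveEnergy_congr_ae {f g : ℝ → ℝ} (h : f =ᵐ[volume] g) :
    dispersiveEnergy f = dispersiveEnergy g := by
  have h' : (fun x => (f x : ℂ)) =ᵐ[volume] fun x => (g x : ℂ) := by
    filter_upwards [h] with x hx
    rw [hx]
  unfold dispersiveEnergy
  by_cases hf : MemLp (fun x => (f x : ℂ)) 2 (volume : Measure ℝ)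
  · have hg := (memLp_congr_ae h').1 hf
    rw [dif_pos hf, dif_pos hg, MemLp.toLp_congr hf hg h']
  · rw [dif_neg hf, dif_neg fun hg => hf ((memLp_congr_ae h').2 hg)]

theorem max_sub_le_sq_div {B : ℝ} (hB : 0 < B) (y : ℝ) : max (|y| - B) 0 ≤ y ^ 2 / B := by
  refine max_le ?_ (by positivity)
  rw [le_div_iff₀ hB, ← sq_abs y]
  nlinarith [sq_nonneg (|y| - B), abs_nonneg y]

/-- A function on `[-R, R]` with modular at most one and a definite mass above the height `B`
has less energy than some competitor supported on a bounded interval. -/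
theorem exists_energy_lt {a σ δ θ ε R : ℝ} (ha : 0 < a) (hσ : 0 ≤ σ) (hσ' : σ ≤ 1 / 10)
    (hδ : 0 < δ) (hθ : 0 ≤ θ) (hR : 0 ≤ R) {η : ℝ} (hη : 0 < η)
    (hgain : η ≤ 1 / 5 * (2 * θ * ε - (2 * θ * δ + θ ^ 2) / heightB a ^ 2 * (3 / a))
      - (σ + 3 * δ / a) * (3 / a))
    {f : ℝ → ℝ} (hm : Measurable f) (hs : ∀ x, f x ≠ 0 → |x| ≤ R)
    (hi : Integrable fun x => youngPsi a (f x)) (h1 : ∫ x, youngPsi a (f x) ≤ 1)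
    (hc : 1 - σ ≤ a * dispersiveEnergy f ^ 2)
    (hε : ε ≤ ∫ x, max (|f x| - heightB a) 0) {l : ℕ}
    (hl : 3 / (a * η) * (2 * (3 / a / δ ^ 2 + 1) + 2 / heightB a ^ 2 * (3 / a)) ≤ 2 ^ l) :
    ∃ g ∈ localConstraint a l, dispersiveEnergy f < dispersiveEnergy g := by
  have hB := heightB_pos ha
  set B := heightB a with hBdef
  have hfL : MemLp f 2 := by
    rw [memLp_two_iff_integrable_sq hm.aestronglyMeasurable]
    refine (hi.const_mul (3 / a)).mono (hm.pow_const 2).aestronglyMeasurable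
      (Eventually.of_forall fun x => ?_)
    rw [Real.norm_eq_abs, Real.norm_eq_abs, abs_of_nonneg (sq_nonneg _),
      abs_of_nonneg (mul_nonneg (by positivity) (youngPsi_nonneg ha _))]
    have := third_mul_sq_le_youngPsi ha (f x)
    calc f x ^ 2 = 3 / a * (a / 3 * f x ^ 2) := by field_simp
      _ ≤ _ := by gcongr
  have hf1 := integrable_of_memLp_two_of_support hfL hs
  have hS : ∫ x, f x ^ 2 ≤ 3 / a := by
    calc ∫ x, f x ^ 2 ≤ ∫ x, 3 / a * youngPsi a (f x) := by
          refine integral_mono hfL.integrable_sq (hi.const_mul _) fun x => ?_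
          have := third_mul_sq_le_youngPsi ha (f x)
          calc f x ^ 2 = 3 / a * (a / 3 * f x ^ 2) := by field_simp
            _ ≤ _ := by gcongr
      _ = 3 / a * ∫ x, youngPsi a (f x) := integral_const_mul _ _
      _ ≤ 3 / a * 1 := by gcongr
      _ = 3 / a := mul_one _
  have hGM := gaussMix_whithamSymbol_sq
  set c := dispersiveEnergy f ^ 2 with hcdef
  have hc0 : 0 ≤ c := sq_nonneg _
  have hcE : c = symbolEnergy (fun x => whithamSymbol (1 / 4) x ^ 2) f :=
    dispersiveEnergy_sq hf1 hfL
  have hc3 : c ≤ 3 / a := by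
    rw [hcE]
    refine (hGM.energy_le hf1 hfL).trans ?_
    rw [whithamSymbol_sq_zero, one_mul]
    exact hS
  obtain ⟨g, hgm, hgL, hgs, hgE, hgG⟩ := exists_truncation hm hfL hR hs hδ hB
  have hg1 := integrable_of_memLp_two_of_support hgL hgs
  have hE := hgE _ hGM
  rw [whithamSymbol_sq_zero, mul_one, ← hcE] at hE
  have hΨm := measurable_youngPsi a
  set E := symbolEnergy (fun x => whithamSymbol (1 / 4) x ^ 2) g with hEdef
  -- the modular of `g`
  have hp1 : ∀ z : ℝ, 0 ≤ max (z - B) 0 := fun z => le_max_right _ _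
  have hΨle : ∀ x, (1 + 2 / B * max (max (|f x| - δ) 0 - B) 0) *
      youngPsi a (min (max (|f x| - δ) 0) B) ≤ youngPsi a (f x) := by
    intro x
    have hz0 : 0 ≤ max (|f x| - δ) 0 := le_max_right _ _
    have hz : max (|f x| - δ) 0 ≤ |f x| := max_le (by linarith) (abs_nonneg _)
    refine le_trans ?_ ((youngPsi_le_of_le ha hz0 hz).trans_eq (youngPsi_abs a _))
    generalize max (|f x| - δ) 0 = z at *
    rcases le_total z B with h | h
    · rw [max_eq_right (by linarith), min_eq_left h]; simp
    · rw [max_eq_left (by linarith), min_eq_right h, mul_comm]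
      have e := youngPsi_heightB_mul ha (sub_nonneg.2 h)
      rw [← hBdef, add_sub_cancel] at e
      rw [e]
      have hBa := (heightB_bounds ha).1
      have : 0 ≤ 3 * (B - a) * (z - B) ^ 2 :=
        mul_nonneg (by rw [hBdef]; linarith) (sq_nonneg _)
      have : 0 ≤ (z - B) ^ 3 := pow_nonneg (by linarith) 3
      linarith
  obtain ⟨hgi, hgv⟩ := hgG (youngPsi a) hΨm (youngPsi_zero ha)
  have hwi : Integrable fun x => (1 + 2 / B * max (max (|f x| - δ) 0 - B) 0) *
      youngPsi a (min (max (|f x| - δ) 0) B) := by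
    refine hi.mono ?_ (Eventually.of_forall fun x => ?_)
    · have hz : Measurable fun x => max (|f x| - δ) 0 :=
        ((measurable_norm.comp hm).sub_const δ).max measurable_const
      exact (((((hz.sub_const B).max measurable_const).const_mul _).const_add 1).mul
        (hΨm.comp (hz.min measurable_const))).aestronglyMeasurable
    · have : 0 ≤ 2 / B * max (max (|f x| - δ) 0 - B) 0 := by positivity
      rw [Real.norm_eq_abs, Real.norm_eq_abs, abs_of_nonneg (youngPsi_nonneg ha _),
        abs_of_nonneg (mul_nonneg (by linarith) (youngPsi_nonneg ha _))]
      exact hΨle x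
  have hΨg : Integrable fun t => youngPsi a (g t) := hgi.2 hwi
  set P := ∫ t, youngPsi a (g t) with hP
  have hP1 : P ≤ 1 := by
    rw [hgv]
    exact (integral_mono hwi hi hΨle).trans h1
  -- the gain
  have hgain2 : c * P + η ≤ E := by
    obtain ⟨hHi, hHv⟩ := hgG (fun y => y ^ 2 - c * youngPsi a y)
      ((measurable_id.pow_const 2).sub (hΨm.const_mul c)) (by simp [youngPsi_zero ha])
    have hHg : Integrable fun t => g t ^ 2 - c * youngPsi a (g t) :=
      hgL.integrable_sq.sub (hΨg.const_mul c)
    have hv : (∫ t, g t ^ 2) - c * P = ∫ t, (g t ^ 2 - c * youngPsi a (g t)) := by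
      rw [integral_sub hgL.integrable_sq (hΨg.const_mul c), integral_const_mul]
    rw [hHv] at hv
    have hhi : Integrable fun x => max (|f x| - B) 0 := by
      refine (hfL.integrable_sq.div_const B).mono
        (((measurable_norm.comp hm).sub_const B).max measurable_const).aestronglyMeasurable
        (Eventually.of_forall fun x => ?_)
      rw [Real.norm_eq_abs, Real.norm_eq_abs, abs_of_nonneg (hp1 _),
        abs_of_nonneg (by positivity : 0 ≤ f x ^ 2 / B)]
      exact max_sub_le_sq_div hB (f x)
    have i1 : Integrable fun x => f x ^ 2 - c * youngPsi a (f x) :=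
      hfL.integrable_sq.sub (hi.const_mul c)
    have i2 : Integrable fun x => (σ + 3 * δ / a) * f x ^ 2 := hfL.integrable_sq.const_mul _
    have i3 : Integrable fun x => 2 * θ * max (|f x| - B) 0 := hhi.const_mul _
    have i4 : Integrable fun x => (2 * θ * δ + θ ^ 2) / B ^ 2 * f x ^ 2 :=
      hfL.integrable_sq.const_mul _
    have i34 : Integrable fun x => 1 / 5 * (2 * θ * max (|f x| - B) 0
        - (2 * θ * δ + θ ^ 2) / B ^ 2 * f x ^ 2) := (i3.sub i4).const_mul _
    have i12 : Integrable fun x => f x ^ 2 - c * youngPsi a (f x)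
      - (σ + 3 * δ / a) * f x ^ 2 := i1.sub i2
    -- This bounds `∫ g² - c P` below by `∫ f² - c + η`. Combined with `c - E ≤ ∫ f² - ∫ g²`, the
    -- `L²` norms cancel.
    have hmono := integral_mono (i12.add i34) (hHi.1 hHg) fun x =>
      truncation_gain ha hc0 hc hc3 hσ hσ' hδ.le hθ (f x)
    simp only [Pi.add_apply] at hmono
    rw [integral_add i12 i34, integral_sub i1 i2, integral_const_mul, integral_const_mul,
      integral_sub i3 i4, integral_const_mul, integral_const_mul,
      integral_sub hfL.integrable_sq (hi.const_mul c), integral_const_mul] at hmono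
    have j1 : (σ + 3 * δ / a) * ∫ x, f x ^ 2 ≤ (σ + 3 * δ / a) * (3 / a) := by gcongr
    have j2 : (2 * θ * δ + θ ^ 2) / B ^ 2 * ∫ x, f x ^ 2
        ≤ (2 * θ * δ + θ ^ 2) / B ^ 2 * (3 / a) := by gcongr
    have j3 : 2 * θ * ε ≤ 2 * θ * ∫ x, max (|f x| - B) 0 := by gcongr
    have j4 : c * ∫ x, youngPsi a (f x) ≤ c * 1 := by gcongr
    linarith
  -- Since `η ≤ E ≤ ∫ g² ≤ 3P/a`, the modular of `g` cannot be small. This bounds the dilation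
  -- factor `1/P`, and with it the support of the competitor, independently of `l`.
  have hP0 : a * η / 3 ≤ P := by
    have k1 : E ≤ ∫ t, g t ^ 2 := by
      have := hGM.energy_le hg1 hgL
      rwa [whithamSymbol_sq_zero, one_mul] at this
    have k2 : ∫ t, a / 3 * g t ^ 2 ≤ P :=
      integral_mono (hgL.integrable_sq.const_mul _) hΨg fun t => third_mul_sq_le_youngPsi ha (g t)
    rw [integral_const_mul] at k2
    have k3 : 0 ≤ P := integral_nonneg fun t => youngPsi_nonneg ha _
    have k4 : 0 ≤ c * P := mul_nonneg hc0 k3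
    calc a * η / 3 = a / 3 * η := by ring
      _ ≤ a / 3 * ∫ t, g t ^ 2 := by
          gcongr
          linarith
      _ ≤ P := k2
  have hPpos : 0 < P := lt_of_lt_of_le (by positivity) hP0
  have hu1 : 1 ≤ P⁻¹ := (one_le_inv₀ hPpos).2 hP1
  have hu0 : 0 < P⁻¹ := by positivity
  have hGm : Measurable fun x => g (x / P⁻¹) := hgm.comp (measurable_id.div_const _)
  have hGL : MemLp (fun x => g (x / P⁻¹)) 2 := by
    rw [memLp_two_iff_integrable_sq hGm.aestronglyMeasurable]
    exact hgL.integrable_sq.comp_div hu0.ne'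
  refine ⟨fun x => g (x / P⁻¹), mem_localConstraint ha hGm (hΨg.comp_div hu0.ne') ?_
    fun x hx => ?_, ?_⟩
  · rw [Measure.integral_comp_div (fun x => youngPsi a (g x)), abs_of_pos hu0, smul_eq_mul]
    exact inv_mul_cancel₀ hPpos.ne'
  · have hx' := hgs _ hx
    rw [abs_div, abs_of_pos hu0, div_le_iff₀ hu0] at hx'
    refine le_trans ?_ hl
    have hu : P⁻¹ ≤ 3 / (a * η) := by
      rw [inv_le_comm₀ hPpos (by positivity), inv_div]
      exact hP0
    have hS0 : 0 ≤ ∫ x, f x ^ 2 := integral_nonneg fun x => sq_nonneg _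
    refine hx'.trans ?_
    rw [mul_comm]
    gcongr
  · have hlow := hGM.mul_energy_le_comp_div hu1 hg1 hgL
    rw [← dispersiveEnergy_sq (hg1.comp_div hu0.ne') hGL] at hlow
    refine lt_of_pow_lt_pow_left₀ 2 (dispersiveEnergy_nonneg _) ?_
    rw [← hcdef]
    refine lt_of_lt_of_le ?_ hlow
    calc c = P⁻¹ * (c * P) := by field_simp
      _ < P⁻¹ * E := by
          gcongr
          linarith

theorem mainTheorem3 (α : ℝ) (hα : 0 < α) :
    (0 < heightB α ∧ |heightB α - 1.48 * α| ≤ 0.005 * α ∧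
      ∀ y : ℝ, 0 < y →
        (2 * youngPsi α y = y * deriv (youngPsi α) y ↔ y = heightB α)) ∧
    ∀ ε : ℝ, 0 < ε → ∃ l₀ : ℕ, ∀ l : ℕ, l₀ < l → ∀ f : ℝ → ℝ, IsLocalMaximiser α l f →
      IntegrableOn (fun x => |f x - heightB α|) {x | heightB α ≤ f x} ∧
      ∫ x in {x | heightB α ≤ f x}, |f x - heightB α| < ε := by
  have hB := heightB_pos hα
  refine ⟨⟨hB, ?_, fun y hy => two_mul_youngPsi_eq_iff hα hy⟩, fun ε hε => ?_⟩
  · obtain ⟨h1, h2⟩ := heightB_bounds hα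
    rw [abs_le]
    constructor <;> linarith
  set B := heightB α with hBdef
  set S : ℝ := 3 / α with hS
  have hS0 : 0 < S := by positivity
  -- `S` bounds `∫ f²`. This `θ` makes the `θ²` loss equal to `θε/2`, and the first bound on `δ`
  -- keeps the cross term below `θε/2`. Of the gain there remains `θε/5 = 2η`, of which the lowering
  -- error takes at most `η`, half through `δ` and half through `σ`. None of these numbers depends
  -- on `l` or `f`.
  set θ : ℝ := ε * B ^ 2 / (2 * S) with hθ
  have hθ0 : 0 < θ := by positivity
  set η : ℝ := θ * ε / 10 with hη
  have hη0 : 0 < η := by positivity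
  set δ : ℝ := min (ε * B ^ 2 / (4 * S)) (η * α / (6 * S)) with hδ
  have hδ0 : 0 < δ := by positivity
  set σ : ℝ := min (1 / 10) (η / (2 * S)) with hσ
  have hσ0 : 0 < σ := by positivity
  have hgain : η ≤ 1 / 5 * (2 * θ * ε - (2 * θ * δ + θ ^ 2) / B ^ 2 * S)
      - (σ + 3 * δ / α) * S := by
    have e1 : θ ^ 2 / B ^ 2 * S = θ * ε / 2 := by
      calc θ ^ 2 / B ^ 2 * S = θ * (θ * S / B ^ 2) := by ring
        _ = θ * (ε / 2) := by rw [hθ]; field_simp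
        _ = _ := by ring
    have e2 : 2 * θ * δ / B ^ 2 * S ≤ θ * ε / 2 := by
      calc 2 * θ * δ / B ^ 2 * S ≤ 2 * θ * (ε * B ^ 2 / (4 * S)) / B ^ 2 * S := by
            gcongr
            exact min_le_left _ _
        _ = θ * ε / 2 := by field_simp; ring
    have e3 : 3 * δ / α * S ≤ η / 2 := by
      calc 3 * δ / α * S ≤ 3 * (η * α / (6 * S)) / α * S := by
            gcongr
            exact min_le_right _ _
        _ = η / 2 := by field_simp; ring
    have e4 : σ * S ≤ η / 2 := by
      calc σ * S ≤ η / (2 * S) * S := by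
            gcongr
            exact min_le_right _ _
        _ = η / 2 := by field_simp
    have e5 : (2 * θ * δ + θ ^ 2) / B ^ 2 * S = 2 * θ * δ / B ^ 2 * S + θ ^ 2 / B ^ 2 * S := by
      ring
    have e6 : θ * ε = 10 * η := by rw [hη]; ring
    rw [e5, add_mul]
    linarith
  have hpow : Tendsto (fun l : ℕ => (2 : ℝ) ^ l) atTop atTop :=
    tendsto_pow_atTop_atTop_of_one_lt (by norm_num)
  obtain ⟨l₀, hl₀⟩ := eventually_atTop.1 ((eventually_exists_energy_ge hα hσ0).and
    (hpow.eventually_ge_atTop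
      (3 / (α * η) * (2 * (S / δ ^ 2 + 1) + 2 / B ^ 2 * S))))
  refine ⟨l₀, fun l hl f hf => ?_⟩
  obtain ⟨⟨F, hF, hFE⟩, hlarge⟩ := hl₀ l hl.le
  obtain ⟨⟨⟨hfm, hfO⟩, hgauge, hsupp⟩, hmax⟩ := hf
  have hfL : MemLp f 2 := MemOrlicz.memLp_two hα ⟨hfm, hfO⟩
  have hind : EqOn (fun x => |f x - B|) (fun x => max (f x - B) 0) {x | B ≤ f x} := by
    intro x hx
    have hx : B ≤ f x := hx
    simp only
    rw [abs_of_nonneg (by linarith), max_eq_left (by linarith)]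
  have hnull : NullMeasurableSet {x | B ≤ f x} :=
    nullMeasurableSet_le aemeasurable_const hfm.aemeasurable
  have hmaxm : AEStronglyMeasurable (fun x => max (|f x| - B) 0) := by
    have := hfm.aemeasurable
    exact (AEMeasurable.max ((measurable_norm.comp_aemeasurable this).sub_const B)
      aemeasurable_const).aestronglyMeasurable
  have hmaxi : Integrable fun x => max (|f x| - B) 0 := by
    refine (hfL.integrable_sq.div_const B).mono hmaxm (Eventually.of_forall fun x => ?_)
    rw [Real.norm_eq_abs, Real.norm_eq_abs, abs_of_nonneg (le_max_right _ _),
      abs_of_nonneg (by positivity : 0 ≤ f x ^ 2 / B)]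
    exact max_sub_le_sq_div hB (f x)
  have hle : ∀ x ∈ {x | B ≤ f x}, |f x - B| ≤ max (|f x| - B) 0 := fun x hx => by
    have hx : B ≤ f x := hx
    rw [abs_of_nonneg (by linarith)]
    exact le_max_of_le_left (by linarith [le_abs_self (f x)])
  have hint : IntegrableOn (fun x => |f x - B|) {x | B ≤ f x} := by
    refine Integrable.mono' hmaxi.integrableOn ?_
      ((ae_restrict_iff'₀ hnull).2 (Eventually.of_forall fun x hx => ?_))
    · exact ((hfm.sub aestronglyMeasurable_const).norm).restrict
    · rw [Real.norm_eq_abs, abs_abs]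
      exact hle x hx
  refine ⟨hint, ?_⟩
  by_contra! hcon
  -- a measurable representative that vanishes outside the interval
  obtain ⟨f₀, hf₀m, hf₀⟩ := hfm.aemeasurable
  set f' : ℝ → ℝ := (Icc (-(2 : ℝ) ^ l) (2 ^ l)).indicator f₀ with hf'
  have hf'm : Measurable f' := hf₀m.indicator measurableSet_Icc
  have hae : f =ᵐ[volume] f' := by
    filter_upwards [hf₀, hsupp] with x h1 h2
    by_cases hx : x ∈ Icc (-(2 : ℝ) ^ l) (2 ^ l)
    · rw [hf', indicator_of_mem hx, h1]
    · rw [hf', indicator_of_notMem hx, h2 hx]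
  have hf's : ∀ x, f' x ≠ 0 → |x| ≤ 2 ^ l := fun x hx => by
    by_contra h
    exact hx (indicator_of_notMem (s := Icc (-(2 : ℝ) ^ l) (2 ^ l)) (fun h' => h (abs_le.2 h')) _)
  have hmod : ∫⁻ x, ENNReal.ofReal (youngPsi α (f' x)) ≤ 1 := by
    refine le_trans (le_of_eq (lintegral_congr_ae ?_)) (modular_le_one hα hfm hgauge)
    filter_upwards [hae] with x hx
    rw [hx]
  have hΨm : Measurable fun x => youngPsi α (f' x) := (measurable_youngPsi α).comp hf'm
  have hΨ0 : 0 ≤ᵐ[volume] fun x => youngPsi α (f' x) :=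
    Eventually.of_forall fun x => youngPsi_nonneg hα _
  have hΨi : Integrable fun x => youngPsi α (f' x) := by
    refine ⟨hΨm.aestronglyMeasurable, ?_⟩
    rw [hasFiniteIntegral_iff_ofReal hΨ0]
    exact hmod.trans_lt ENNReal.one_lt_top
  have hΨ1 : ∫ x, youngPsi α (f' x) ≤ 1 := by
    rw [integral_eq_lintegral_of_nonneg_ae hΨ0 hΨm.aestronglyMeasurable]
    exact ENNReal.toReal_le_of_le_ofReal zero_le_one (by simpa using hmod)
  have hEeq := dispersiveEnergy_congr_ae hae
  have hEF : dispersiveEnergy F ≤ dispersiveEnergy f := hmax hF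
  have hc : 1 - σ ≤ α * dispersiveEnergy f' ^ 2 := by
    rw [← hEeq]
    refine hFE.trans ?_
    have := dispersiveEnergy_nonneg F
    gcongr
  have hεf : ε ≤ ∫ x, max (|f' x| - B) 0 := by
    calc ε ≤ ∫ x in {x | B ≤ f x}, |f x - B| := hcon
      _ ≤ ∫ x in {x | B ≤ f x}, max (|f x| - B) 0 :=
          setIntegral_mono_on₀ hint hmaxi.integrableOn hnull hle
      _ ≤ ∫ x, max (|f x| - B) 0 :=
          setIntegral_le_integral hmaxi (Eventually.of_forall fun x => le_max_right _ _)
      _ = _ := by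
          refine integral_congr_ae ?_
          filter_upwards [hae] with x hx
          rw [hx]
  obtain ⟨g, hg, hlt⟩ := exists_energy_lt hα hσ0.le (min_le_left _ _) hδ0 hθ0.le
    (by positivity : (0 : ℝ) ≤ 2 ^ l) hη0 hgain hf'm hf's hΨi hΨ1 hc hεf hlarge
  have hgf : dispersiveEnergy g ≤ dispersiveEnergy f := hmax hg
  rw [hEeq] at hgf
  exact absurd hlt (not_lt.2 hgf)
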